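/- **Conventions.** Let $X$ be a metric space and $A$ an abelian group. An entourage of $X$ is a set $E\subseteq X\times X$ on which the distance is bounded, and $E[B]=\{x : (x,y)\in E \text{ for some } y\in B\}$. A map $\alpha:X\to Y$ of metric spaces is *coarse* if for every $R$ there is $S$ such that $d(x,y)\le R$ implies $d(\alpha(x),\alpha(y))\le S$, and preimages of bounded sets are bounded. A finite (possibly empty) family of subsets $U_1,\dots,U_n\subseteq U$ is a *coarse cover* of $U\subseteq X$ if for every entourage $E\subseteq U\times U$ the set $U\cap E[U\setminus U_1]\cap\dots\cap E[U\setminus U_n]$ is bounded. The site $X_{ct}$ is the poset of subsets of $X$ with the coarse covers as coverings. $A_X$ is the constant sheaf (sheafification of the constant presheaf $A$) on $X_{ct}$, and $\check H^q_{ct}(X;\mathcal F)$ is the $q$-th right derived functor of $\mathcal F\mapsto \mathcal F(X)$ on sheaves of abelian groups on $X_{ct}$. A set $C\subseteq X^{q+1}$ is *cocontrolled* if for every $R$ all projections to $X$ of $\{x\in C: d(x_i,x_j)\le R\ \forall i,j\}$ are bounded. For $U\subseteq X$ let $C^q(U,A)$ be the group of *blocky* functions $\varphi:U^{q+1}\to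 A$, i.e. those for which there is a finite partition $U=A_1\sqcup\dots\sqcup A_n$ such that $\varphi$ is constant on each $A_{i_0}\times\dots\times A_{i_q}$; let $CX^q_b(U,A)$ be the subgroup of those with cocontrolled support, and $CY^q_b(U,A)=C^q(U,A)/CX^q_b(U,A)$, with differential $(d\varphi)(x_0,\dots,x_{q+1})=\sum_i(-1)^i\varphi(x_0,\dots,\hat x_i,\dots,x_{q+1})$. Then $U\mapsto CY^q_b(U,A)$ is a sheaf on $X_{ct}$. $HY^q_b(X,A)$ is the $q$-th cohomology of $CY^*_b(X,A)$. For a coarse map $\alpha:X\to Y$, the direct image is $(\alpha_*\mathcal F)(V)=\mathcal F(\alpha^{-1}(V))$ and the inverse image $\alpha^*\mathcal G$ is the sheafification of $U\mapsto\mathcal G(\alpha(U))$; $\alpha^*$ is exact and left adjoint to $\alpha_*$, and there is a canonical isomorphism $\alpha^*A_Y\cong A_X$. If $\mathcal G\to\mathcal I^\bullet$ is an injective resolution, then $\alpha^*\mathcal G\to\alpha^*\mathcal I^\bullet$ is a resolution, and the unit of the adjunction gives maps $\check H^q_{ct}(Y;\mathcal G)=H^q(\mathcal I^\bullet(Y))\to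 H^q((\alpha^*\mathcal I^\bullet)(X))\to\check H^q_{ct}(X;\alpha^*\mathcal G)$. For $\mathcal G=A_Y$ the composite, followed by the isomorphism induced by $\alpha^*A_Y\cong A_X$, is the map $\alpha^*:\check H^q_{ct}(Y;A_Y)\to\check H^q_{ct}(X;A_X)$ induced by the inverse image functor. (For any resolution $\mathcal F\to\mathcal K^\bullet$ the canonical map $H^q(\mathcal K^\bullet(X))\to\check H^q_{ct}(X;\mathcal F)$ is induced by a morphism from $\mathcal K^\bullet$ to an injective resolution of $\mathcal F$ under $\mathcal F$.) **Theorem.** Let $\alpha:X\to Y$ be a coarse map of metric spaces, $A$ an abelian group and $q\ge0$. The constant functions make $CY^*_b(\cdot,A)$ a resolution of $A_X$ on $X_{ct}$ and of $A_Y$ on $Y_{ct}$, the resulting canonical maps $$c_X:HY^q_b(X,A)\to\check H^q_{ct}(X;A_X),\qquad c_Y:HY^q_b(Y,A)\to\check H^q_{ct}(Y;A_Y)$$ are isomorphisms, and under them the map $\alpha^*:\check H^q_{ct}(Y;A_Y)\to\check H^q_{ct}(X;A_X)$ induced by the inverse image functor coincides with the map $\alpha^*:HY^q_b(Y,A)\to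 HY^q_b(X,A)$ induced by $\varphi\mapsto\varphi\circ\alpha^{\times(q+1)}$; that is, $\alpha^*\circ c_Y=c_X\circ\alpha^*$. -/

import Mathlib

open CategoryTheory Opposite

universe u

noncomputable section

namespace CoarseSheaf

/-! ### Coarse geometry of metric spaces -/

section CoarseGeometry

variable {X Y : Type*} [MetricSpace X] [MetricSpace Y]

/-- A set of pairs is an entourage if the distance is bounded on it. -/
def IsEntourage (E : Set (X × X)) : Prop :=
  ∃ R : ℝ, ∀ p ∈ E, dist p.1 p.2 ≤ R

/-- `E[B]`, the set of all `x` with `(x, y) ∈ E` for some `y ∈ B`. -/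
def thickening (E : Set (X × X)) (B : Set X) : Set X :=
  {x | ∃ y ∈ B, (x, y) ∈ E}

/-- `α` is coarsely uniform. -/
def IsCoarselyUniform (α : X → Y) : Prop :=
  ∀ R : ℝ, ∃ S : ℝ, ∀ x y : X, dist x y ≤ R → dist (α x) (α y) ≤ S

/-- `α` is coarsely proper: preimages of bounded sets are bounded. -/
def IsCoarselyProper (α : X → Y) : Prop :=
  ∀ B : Set Y, Bornology.IsBounded B → Bornology.IsBounded (α ⁻¹' B)

/-- `α` is a coarse map. -/
structure IsCoarse (α : X → Y) : Prop where
  uniform : IsCoarselyUniform α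
  proper : IsCoarselyProper α

/-- The finite family `V 0, …, V (n - 1)` is a coarse cover of the subset `U`: every `V i` is a
subset of `U`, and for every entourage `E ⊆ U × U` the intersection of the sets
`E[U \ V i]` inside `U` is bounded. The empty family (`n = 0`) is allowed; it covers
exactly the bounded sets. -/
structure IsCoarseCover (U : Set X) {n : ℕ} (V : Fin n → Set X) : Prop where
  subset : ∀ i, V i ⊆ U
  isBounded : ∀ E : Set (X × X), IsEntourage E → E ⊆ U ×ˢ U →
    Bornology.IsBounded (U ∩ ⋂ i, thickening E (U \ V i))

/-- The Vietoris-Rips simplices `Δ_R^q`: tuples with pairwise distances at most `R`. -/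
def vietorisRips (X : Type*) [MetricSpace X] (q : ℕ) (R : ℝ) : Set (Fin (q + 1) → X) :=
  {x | ∀ i j, dist (x i) (x j) ≤ R}

/-- `C` is cocontrolled: for every `R` all projections of `C ∩ Δ_R^q` are bounded. -/
def IsCocontrolled {q : ℕ} (C : Set (Fin (q + 1) → X)) : Prop :=
  ∀ R : ℝ, ∀ i, Bornology.IsBounded ((fun x : Fin (q + 1) → X ↦ x i) '' (C ∩ vietorisRips X q R))

lemma isCoarse_val (U : Set X) : IsCoarse (Subtype.val : U → X) where
  uniform R := ⟨R, fun _ _ h ↦ h⟩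
  proper B hB := by
    rw [Metric.isBounded_iff] at hB ⊢
    obtain ⟨C, hC⟩ := hB
    exact ⟨C, fun x hx y hy ↦ hC hx hy⟩

lemma isCoarse_inclusion {U V : Set X} (h : U ⊆ V) : IsCoarse (Set.inclusion h) where
  uniform R := ⟨R, fun _ _ h ↦ h⟩
  proper B hB := by
    rw [Metric.isBounded_iff] at hB ⊢
    obtain ⟨C, hC⟩ := hB
    exact ⟨C, fun x hx y hy ↦ hC hx hy⟩

lemma isCoarseCover_iff {U : Set X} {n : ℕ} {V : Fin n → Set X} :
    IsCoarseCover U V ↔ (∀ i, V i ⊆ U) ∧ ∀ R : ℝ,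
      Bornology.IsBounded {x | x ∈ U ∧ ∀ i, ∃ y ∈ U, y ∉ V i ∧ dist x y ≤ R} := by
  constructor
  · intro h
    refine ⟨h.subset, fun R ↦ ?_⟩
    refine (h.isBounded {p | p.1 ∈ U ∧ p.2 ∈ U ∧ dist p.1 p.2 ≤ R}
      ⟨R, fun p hp ↦ hp.2.2⟩ (fun p hp ↦ ⟨hp.1, hp.2.1⟩)).subset ?_
    rintro x ⟨hx, hx'⟩
    refine ⟨hx, Set.mem_iInter.2 fun i ↦ ?_⟩
    obtain ⟨y, hy, hy', hxy⟩ := hx' i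
    exact ⟨y, ⟨hy, hy'⟩, hx, hy, hxy⟩
  · rintro ⟨h, h'⟩
    refine ⟨h, fun E ⟨R, hR⟩ _ ↦ (h' R).subset ?_⟩
    rintro x ⟨hx, hx'⟩
    refine ⟨hx, fun i ↦ ?_⟩
    obtain ⟨y, ⟨hy, hy'⟩, hxy⟩ := Set.mem_iInter.1 hx' i
    exact ⟨y, hy, hy', hR _ hxy⟩

lemma IsCocontrolled.mono {q : ℕ} {C D : Set (Fin (q + 1) → X)} (hD : IsCocontrolled D)
    (h : C ⊆ D) : IsCocontrolled C :=
  fun R i ↦ (hD R i).subset (Set.image_mono (Set.inter_subset_inter_left _ h))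

lemma IsCocontrolled.union {q : ℕ} {C D : Set (Fin (q + 1) → X)} (hC : IsCocontrolled C)
    (hD : IsCocontrolled D) : IsCocontrolled (C ∪ D) := by
  intro R i
  rw [Set.union_inter_distrib_right, Set.image_union]
  exact (hC R i).union (hD R i)

lemma isCocontrolled_empty {q : ℕ} : IsCocontrolled (∅ : Set (Fin (q + 1) → X)) := by
  intro R i
  simp

lemma isCocontrolled_iUnion {q : ℕ} {ι : Type*} [Finite ι] {C : ι → Set (Fin (q + 1) → X)}
    (hC : ∀ k, IsCocontrolled (C k)) : IsCocontrolled (⋃ k, C k) := by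
  intro R i
  rw [Set.iUnion_inter, Set.image_iUnion]
  exact Bornology.isBounded_iUnion.2 fun k ↦ hC k R i

lemma IsCocontrolled.preimage {α : X → Y} (hα : IsCoarse α) {q : ℕ}
    {C : Set (Fin (q + 1) → Y)} (hC : IsCocontrolled C) :
    IsCocontrolled {x : Fin (q + 1) → X | α ∘ x ∈ C} := by
  intro R i
  obtain ⟨S, hS⟩ := hα.uniform R
  refine (hα.proper _ (hC S i)).subset ?_
  rintro _ ⟨x, ⟨hx, hxR⟩, rfl⟩
  exact ⟨α ∘ x, ⟨hx, fun j k ↦ hS _ _ (hxR j k)⟩, rfl⟩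

/-- Omitting a coordinate preserves cocontrolled sets. -/
lemma IsCocontrolled.face {q : ℕ} {C : Set (Fin (q + 1) → X)} (hC : IsCocontrolled C)
    (k : Fin (q + 2)) :
    IsCocontrolled {x : Fin (q + 2) → X | x ∘ k.succAbove ∈ C} := by
  intro R i
  obtain ⟨b, hb⟩ := Metric.isBounded_iff.1 (hC R 0)
  refine Metric.isBounded_iff.2 ⟨R + b + R, ?_⟩
  rintro _ ⟨x, ⟨hx, hxR⟩, rfl⟩ _ ⟨y, ⟨hy, hyR⟩, rfl⟩
  have h := hb ⟨_, ⟨hx, fun j l ↦ hxR _ _⟩, rfl⟩ ⟨_, ⟨hy, fun j l ↦ hyR _ _⟩, rfl⟩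
  have h1 := hxR i (k.succAbove 0)
  have h2 := hyR (k.succAbove 0) i
  have h3 := dist_triangle4 (x i) (x (k.succAbove 0)) (y (k.succAbove 0)) (y i)
  simp only [Function.comp_apply] at h ⊢
  linarith

/-- If the `V i` form a coarse cover of `U`, the tuples of `U` that lie in no `V i ^ (q + 1)` form
a cocontrolled set. -/
lemma IsCoarseCover.isCocontrolled_compl {U : Set X} {n : ℕ} {V : Fin n → Set X}
    (hV : IsCoarseCover U V) (q : ℕ) :
    IsCocontrolled {x : Fin (q + 1) → U | ∀ i, ∃ j, (x j : X) ∉ V i} := by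
  intro R k
  refine ((isCoarse_val U).proper _ ((isCoarseCover_iff.1 hV).2 R)).subset ?_
  rintro _ ⟨x, ⟨hx, hxR⟩, rfl⟩
  refine ⟨(x k).2, fun i ↦ ?_⟩
  obtain ⟨j, hj⟩ := hx i
  exact ⟨x j, (x j).2, hj, hxR k j⟩

end CoarseGeometry

/-! ### Blocky functions -/

section Blocky

variable {X Y : Type*}

/-- A function on `X ^ (q + 1)` is blocky if there is a finite partition of `X` into blocks
`p ⁻¹' {k}` such that the function is constant on every product of `q + 1` blocks. -/
def IsBlocky {q : ℕ} {A : Type*} (φ : (Fin (q + 1) → X) → A) : Prop :=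
  ∃ (n : ℕ) (p : X → Fin n), ∀ x y, (∀ i, p (x i) = p (y i)) → φ x = φ y

lemma IsBlocky.comp {α : X → Y} {q : ℕ} {A : Type*} {φ : (Fin (q + 1) → Y) → A}
    (h : IsBlocky φ) : IsBlocky fun x : Fin (q + 1) → X ↦ φ (α ∘ x) := by
  obtain ⟨n, p, hp⟩ := h
  exact ⟨n, p ∘ α, fun x y hxy ↦ hp _ _ hxy⟩

lemma IsBlocky.face {q : ℕ} {A : Type*} {φ : (Fin (q + 1) → X) → A}
    (h : IsBlocky φ) (k : Fin (q + 2)) :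
    IsBlocky fun x : Fin (q + 2) → X ↦ φ (x ∘ k.succAbove) := by
  obtain ⟨n, p, hp⟩ := h
  exact ⟨n, p, fun x y hxy ↦ hp _ _ fun i ↦ hxy _⟩

lemma isBlocky_const {q : ℕ} {A : Type*} (a : A) :
    IsBlocky fun _ : Fin (q + 1) → X ↦ a :=
  ⟨1, fun _ ↦ 0, fun _ _ _ ↦ rfl⟩

/-- Blockiness may be tested with any finite set of blocks. -/
lemma isBlocky_of_finite {q : ℕ} {A κ : Type*} [Finite κ] {φ : (Fin (q + 1) → X) → A}
    (p : X → κ) (h : ∀ x y, (∀ i, p (x i) = p (y i)) → φ x = φ y) : IsBlocky φ := by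
  obtain ⟨n, ⟨e⟩⟩ := Finite.exists_equiv_fin κ
  exact ⟨n, e ∘ p, fun x y hxy ↦ h x y fun i ↦ e.injective (hxy i)⟩

lemma IsBlocky.map₂ {q : ℕ} {A B C : Type*} {φ : (Fin (q + 1) → X) → A}
    {ψ : (Fin (q + 1) → X) → B} (hφ : IsBlocky φ) (hψ : IsBlocky ψ) (f : A → B → C) :
    IsBlocky fun x ↦ f (φ x) (ψ x) := by
  obtain ⟨n, p, hp⟩ := hφ
  obtain ⟨m, r, hr⟩ := hψ
  refine isBlocky_of_finite (fun x ↦ (p x, r x)) fun x y hxy ↦ ?_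
  simp only [Prod.mk.injEq] at hxy
  rw [hp x y fun i ↦ (hxy i).1, hr x y fun i ↦ (hxy i).2]

end Blocky

/-! ### The cochain complex `CY_b` of a metric space -/

section Cochains

variable (X Y : Type u) [MetricSpace X] [MetricSpace Y] (A : Type u) [AddCommGroup A]

/-- The group `C^q(X, A)` of blocky functions `X ^ (q + 1) → A`. -/
def blocky (X : Type u) (q : ℕ) : AddSubgroup ((Fin (q + 1) → X) → A) where
  carrier := {φ | IsBlocky φ}
  zero_mem' := isBlocky_const 0
  add_mem' h h' := h.map₂ h' (· + ·)
  neg_mem' h := h.map₂ h fun a _ ↦ -a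

/-- The subgroup `CX_b^q(X, A)` of `C^q(X, A)`, of all blocky functions with cocontrolled
support. -/
def cocontrolledBlocky (q : ℕ) : AddSubgroup (blocky A X q) where
  carrier := {φ | IsCocontrolled (Function.support φ.1)}
  zero_mem' := by
    refine isCocontrolled_empty.mono ?_
    intro x hx
    exact hx rfl
  add_mem' h h' := (h.union h').mono (Function.support_add _ _)
  neg_mem' {φ} h := by
    have : Function.support (-φ).1 = Function.support φ.1 := Function.support_neg _
    simpa only [Set.mem_ofPred_eq, this] using h

/-- `CY_b^q(X, A) = C^q(X, A) / CX_b^q(X, A)`. -/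
abbrev CY (q : ℕ) : Type u := blocky A X q ⧸ cocontrolledBlocky X A q

variable {X} in
/-- The map `(x₀, …, x_{q+1}) ↦ φ (x₀, …, x̂_k, …, x_{q+1})`. -/
def faceHom (X : Type u) (q : ℕ) (k : Fin (q + 2)) : blocky A X q →+ blocky A X (q + 1) where
  toFun φ := ⟨fun x ↦ φ.1 (x ∘ k.succAbove), φ.2.face k⟩
  map_zero' := rfl
  map_add' _ _ := rfl

/-- The differential of `C^*(X, A)`, the alternating sum
`(d φ) (x₀, …, x_{q+1}) = ∑ k, (-1)^k φ (x₀, …, x̂_k, …, x_{q+1})`. -/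
def blockyD (X : Type u) (q : ℕ) : blocky A X q →+ blocky A X (q + 1) :=
  ∑ k : Fin (q + 2), (-1 : ℤ) ^ (k : ℕ) • faceHom A X q k

lemma blockyD_apply (X : Type u) (q : ℕ) (φ : blocky A X q) (x : Fin (q + 2) → X) :
    (blockyD A X q φ).1 x = ∑ k : Fin (q + 2), (-1 : ℤ) ^ (k : ℕ) • φ.1 (x ∘ k.succAbove) := by
  simp [blockyD, faceHom]

lemma blockyD_blockyD (X : Type u) (q : ℕ) (φ : blocky A X q) :
    blockyD A X (q + 1) (blockyD A X q φ) = 0 := by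
  ext x
  rw [blockyD_apply]
  simp only [blockyD_apply, Finset.smul_sum, ← Finset.sum_product', smul_smul]
  let P := Fin (q + 3) × Fin (q + 2)
  let S : Finset P := {ij : P | (ij.1 : ℕ) ≤ (ij.2 : ℕ)}
  rw [Finset.univ_product_univ, ← Finset.sum_add_sum_compl S]
  change _ = (0 : A)
  rw [← eq_neg_iff_add_eq_zero, ← Finset.sum_neg_distrib]
  let f : ∀ ij : P, ij ∈ S → P := fun ij hij =>
    (ij.2.succ, Fin.castLT ij.1 (lt_of_le_of_lt (Finset.mem_filter.mp hij).right (Fin.is_lt ij.2)))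
  apply Finset.sum_bij f
  · intro ij hij
    simp_rw [S, f, Finset.compl_filter, Finset.mem_filter_univ, Fin.val_succ,
      Fin.val_castLT] at hij ⊢
    lia
  · rintro ⟨i, j⟩ hij ⟨i', j'⟩ hij' h
    have h1 := congrArg (fun p : P ↦ (p.1 : ℕ)) h
    have h2 := congrArg (fun p : P ↦ (p.2 : ℕ)) h
    simp only [f, Fin.val_succ, Fin.val_castLT, add_left_inj] at h1 h2
    exact Prod.ext (Fin.ext h2) (Fin.ext h1)
  · rintro ⟨i', j'⟩ hij'
    simp_rw [S, Finset.compl_filter, Finset.mem_filter_univ, not_le] at hij'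
    refine ⟨(Fin.castSucc j', i'.pred <| ?_), ?_, ?_⟩
    · rintro rfl
      simp only [Fin.val_zero, not_lt_zero] at hij'
    · simpa [S] using! Nat.le_sub_one_of_lt hij'
    · simp only [f, Fin.castLT_castSucc, Fin.succ_pred]
  · rintro ⟨i, j⟩ hij
    simp only [S, Finset.mem_filter_univ] at hij
    simp only [f, ← neg_smul]
    congr 1
    · simp only [Fin.val_succ, pow_add, pow_one, Fin.val_castLT]
      ring
    · refine congrArg φ.1 (funext fun l ↦ congrArg x (Fin.ext ?_))
      simp only [Fin.succAbove, Fin.lt_def]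
      split_ifs <;> simp_all <;> lia

lemma cocontrolledBlocky_le_comap (q : ℕ) :
    cocontrolledBlocky X A q ≤ (cocontrolledBlocky X A (q + 1)).comap (blockyD A X q) := by
  intro φ hφ
  refine (isCocontrolled_iUnion fun k : Fin (q + 2) ↦ IsCocontrolled.face hφ k).mono ?_
  intro x hx
  by_contra hx'
  simp only [Set.mem_iUnion, Set.mem_ofPred_eq, not_exists, Function.mem_support, ne_eq,
    not_not] at hx'
  exact hx (by rw [blockyD_apply]; exact Finset.sum_eq_zero fun k _ ↦ by rw [hx' k, smul_zero])

/-- The differential of `CY_b^*(X, A)`. -/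
def CYd (q : ℕ) : CY X A q →+ CY X A (q + 1) :=
  QuotientAddGroup.map _ _ (blockyD A X q) (cocontrolledBlocky_le_comap X A q)

lemma CYd_CYd (q : ℕ) (c : CY X A q) : CYd X A (q + 1) (CYd X A q c) = 0 := by
  obtain ⟨φ, rfl⟩ := QuotientAddGroup.mk_surjective c
  exact congrArg QuotientAddGroup.mk (blockyD_blockyD A X q φ)

/-- The cochain complex `CY_b^*(X, A)`. -/
def CYComplex : CochainComplex AddCommGrpCat.{u} ℕ :=
  CochainComplex.of (fun q ↦ AddCommGrpCat.of (CY X A q)) (fun q ↦ AddCommGrpCat.ofHom (CYd X A q))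
    fun q ↦ by ext c; exact CYd_CYd X A q c

/-- The coarse cohomology `HY_b^q(X, A)`. -/
def HY (q : ℕ) : AddCommGrpCat.{u} := (CYComplex X A).homology q

variable {X Y}

/-- Pulling back blocky functions, `φ ↦ φ ∘ α ^ (q + 1)`. -/
def blockyMap {X Y : Type u} (α : X → Y) (q : ℕ) : blocky A Y q →+ blocky A X q where
  toFun φ := ⟨fun x ↦ φ.1 (α ∘ x), φ.2.comp⟩
  map_zero' := rfl
  map_add' _ _ := rfl

lemma cocontrolledBlocky_le_comap_map {α : X → Y} (hα : IsCoarse α) (q : ℕ) :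
    cocontrolledBlocky Y A q ≤ (cocontrolledBlocky X A q).comap (blockyMap A α q) :=
  fun _ hφ ↦ IsCocontrolled.preimage hα hφ

/-- The map `CY_b^q(Y, A) → CY_b^q(X, A)` given by a coarse map, `φ ↦ φ ∘ α ^ (q + 1)`. -/
def CYMap {α : X → Y} (hα : IsCoarse α) (q : ℕ) : CY Y A q →+ CY X A q :=
  QuotientAddGroup.map _ _ (blockyMap A α q) (cocontrolledBlocky_le_comap_map A hα q)

lemma CYMap_CYd {α : X → Y} (hα : IsCoarse α) (q : ℕ) (c : CY Y A q) :
    CYMap A hα (q + 1) (CYd Y A q c) = CYd X A q (CYMap A hα q c) := by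
  obtain ⟨φ, rfl⟩ := QuotientAddGroup.mk_surjective c
  refine congrArg QuotientAddGroup.mk (Subtype.ext (funext fun x ↦ ?_))
  change (blockyD A Y q φ).1 (α ∘ x) = (blockyD A X q (blockyMap A α q φ)).1 x
  rw [blockyD_apply, blockyD_apply]
  rfl

/-- The cochain map `α^* : CY_b^*(Y, A) → CY_b^*(X, A)` of a coarse map `α`. -/
def CYComplexMap {α : X → Y} (hα : IsCoarse α) : CYComplex Y A ⟶ CYComplex X A :=
  CochainComplex.ofHom (fun q ↦ AddCommGrpCat.ofHom (CYMap A hα q)) fun q ↦ by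
    simp only [CYComplex, CochainComplex.of_d]
    ext c
    exact (CYMap_CYd A hα q c).symm

/-- The canonical map `α^* : HY_b^q(Y, A) → HY_b^q(X, A)` of a coarse map `α`. -/
def HYMap {α : X → Y} (hα : IsCoarse α) (q : ℕ) : HY Y A q ⟶ HY X A q :=
  HomologicalComplex.homologyMap (CYComplexMap A hα) q

end Cochains

/-! ### The site `X_ct` -/

section Site

variable {X Y : Type u} [MetricSpace X] [MetricSpace Y]

/-- `S` is the presieve given by the members of a coarse cover of `U`. -/
def IsCoarseCovering (U : Set X) (S : Presieve U) : Prop :=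
  ∃ (n : ℕ) (V : Fin n → Set X) (hV : IsCoarseCover U V),
    S = Presieve.ofArrows V fun i ↦ homOfLE (hV.subset i)

lemma ofArrows_homOfLE_iff {X : Type u} {κ : Type*} {U W : Set X} {V : κ → Set X} (hV : ∀ i, V i ⊆ U)
    (f : W ⟶ U) : Presieve.ofArrows V (fun i ↦ homOfLE (hV i)) f ↔ ∃ i, V i = W := by
  constructor
  · rintro ⟨i⟩
    exact ⟨i, rfl⟩
  · rintro ⟨i, rfl⟩
    exact ⟨i⟩

lemma isCoarseCovering_of_finite {κ : Type*} [Finite κ] {U : Set X} {S : Presieve U}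
    (V : κ → Set X) (hV : ∀ i, V i ⊆ U)
    (h : ∀ R : ℝ, Bornology.IsBounded {x | x ∈ U ∧ ∀ i, ∃ y ∈ U, y ∉ V i ∧ dist x y ≤ R})
    (hS : ∀ (W : Set X) (f : W ⟶ U), S f ↔ ∃ i, V i = W) : IsCoarseCovering U S := by
  obtain ⟨n, ⟨e⟩⟩ := Finite.exists_equiv_fin κ
  refine ⟨n, V ∘ e.symm, isCoarseCover_iff.2 ⟨fun i ↦ hV _, fun R ↦ (h R).subset ?_⟩, ?_⟩
  · rintro x ⟨hx, hx'⟩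
    exact ⟨hx, fun i ↦ by simpa using hx' (e i)⟩
  · refine funext fun W ↦ funext fun f ↦ propext ?_
    refine (hS W f).trans (Iff.trans ?_ (ofArrows_homOfLE_iff (fun i ↦ hV _) f).symm)
    exact ⟨fun ⟨i, hi⟩ ↦ ⟨e i, by simpa using hi⟩, fun ⟨i, hi⟩ ↦ ⟨e.symm i, hi⟩⟩

variable (X)

/-- The coarse covers form a pretopology on the poset of subsets of `X`. -/
def coarsePretopology : Pretopology (Set X) where
  coverings U := {S | IsCoarseCovering U S}
  has_isos U V f _ := by
    obtain rfl : V = U := le_antisymm (leOfHom f) (leOfHom (inv f))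
    refine isCoarseCovering_of_finite (fun _ : Unit ↦ V) (fun _ ↦ le_rfl) (fun R ↦ ?_) ?_
    · refine Bornology.isBounded_empty.subset ?_
      rintro x ⟨-, hx⟩
      obtain ⟨y, hy, hy', -⟩ := hx ()
      exact hy' hy
    · intro W g
      constructor
      · rintro ⟨⟩
        exact ⟨(), rfl⟩
      · rintro ⟨-, rfl⟩
        obtain rfl : g = f := Subsingleton.elim _ _
        exact ⟨⟩
  pullbacks U U' f S := by
    rintro ⟨n, V, hV, rfl⟩
    refine isCoarseCovering_of_finite (fun i ↦ U' ∩ V i) (fun _ ↦ Set.inter_subset_left)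
      (fun R ↦ ((isCoarseCover_iff.1 hV).2 R).subset ?_) ?_
    · rintro x ⟨hx, hx'⟩
      refine ⟨leOfHom f hx, fun i ↦ ?_⟩
      obtain ⟨y, hy, hy', hxy⟩ := hx' i
      exact ⟨y, leOfHom f hy, fun h ↦ hy' ⟨hy, h⟩, hxy⟩
    · have key (V : Set X) (g : V ⟶ U) : Limits.pullback g f = U' ∩ V :=
        le_antisymm (Set.subset_inter (leOfHom (Limits.pullback.snd g f))
          (leOfHom (Limits.pullback.fst g f)))
          (leOfHom (Limits.pullback.lift (homOfLE Set.inter_subset_right)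
            (homOfLE Set.inter_subset_left) (Subsingleton.elim _ _)))
      intro W g
      constructor
      · rintro ⟨_, _, ⟨i⟩⟩
        exact ⟨i, (key _ _).symm⟩
      · rintro ⟨i, rfl⟩
        have := Presieve.pullbackArrows.mk (f := f) _ _ (Presieve.ofArrows.mk
          (f := fun i ↦ homOfLE (hV.subset i)) i)
        have h2 : ∀ (W' : Set X) (e : W' = U' ∩ V i) (g' : W' ⟶ U'),
            Presieve.pullbackArrows f (Presieve.ofArrows V fun i ↦ homOfLE (hV.subset i)) g' →
            Presieve.pullbackArrows f (Presieve.ofArrows V fun i ↦ homOfLE (hV.subset i)) g := by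
          rintro _ rfl g' h
          obtain rfl : g = g' := Subsingleton.elim _ _
          exact h
        exact h2 _ (key _ _) _ this
  transitive U S T := by
    rintro ⟨n, V, hV, rfl⟩ hT
    have hT' (i : Fin n) := hT (homOfLE (hV.subset i)) (Presieve.ofArrows.mk i)
    choose m W hW hS using hT'
    refine isCoarseCovering_of_finite (fun p : Σ i, Fin (m i) ↦ W p.1 p.2)
      (fun p ↦ ((hW p.1).subset p.2).trans (hV.subset p.1)) (fun R ↦ ?_) ?_
    · refine (((isCoarseCover_iff.1 hV).2 (max R 0)).union (Bornology.isBounded_iUnion.2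
        fun i ↦ (isCoarseCover_iff.1 (hW i)).2 R)).subset ?_
      rintro x ⟨hx, hx'⟩
      by_contra hcon
      simp only [Set.mem_union, Set.mem_iUnion, not_or, Set.mem_ofPred_eq, not_and, not_exists,
        not_forall] at hcon
      obtain ⟨i, hi⟩ := hcon.1 hx
      have hi' : ∀ y ∈ U, dist x y ≤ max R 0 → y ∈ V i := fun y hy hxy ↦ by
        by_contra h
        exact hi y hy h hxy
      have hxi : x ∈ V i := hi' x hx (by simp)
      obtain ⟨j, hj⟩ := hcon.2 i hxi
      obtain ⟨y, hy, hy', hxy⟩ := hx' ⟨i, j⟩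
      exact hj y (hi' y hy (hxy.trans (le_max_left _ _))) hy' hxy
    · intro Z g
      constructor
      · rintro ⟨_, g1, _, ⟨i⟩, h, rfl⟩
        rw [hS] at h
        obtain ⟨j, hj⟩ := (ofArrows_homOfLE_iff _ _).1 h
        exact ⟨⟨i, j⟩, hj⟩
      · rintro ⟨⟨i, j⟩, rfl⟩
        refine ⟨V i, homOfLE ((hW i).subset j), homOfLE (hV.subset i), ⟨i⟩, ?_,
          Subsingleton.elim _ _⟩
        rw [hS]
        exact ⟨j⟩

/-- The Grothendieck topology of `X_ct`. -/
def coarseTopology : GrothendieckTopology (Set X) := (coarsePretopology X).toGrothendieck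

/-- The category of sheaves of abelian groups on `X_ct`. -/
abbrev AbSheaf := Sheaf (coarseTopology X) AddCommGrpCat.{u}

/-- The global sections functor on `X_ct`. -/
abbrev globalSections : AbSheaf X ⥤ AddCommGrpCat.{u} :=
  (sheafSections (coarseTopology X) AddCommGrpCat.{u}).obj (op ⊤)

instance : (globalSections X).Additive where

/-- Coarse sheaf cohomology `H_ct^q(X, F)`, the right derived functor of global sections. -/
def cohomology (F : AbSheaf X) (q : ℕ) : AddCommGrpCat.{u} :=
  ((globalSections X).rightDerived q).obj F

/-- The constant sheaf `A_X`, the sheafification of the constant presheaf. -/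
abbrev constSheaf (A : Type u) [AddCommGroup A] : AbSheaf X :=
  (constantSheaf (coarseTopology X) AddCommGrpCat.{u}).obj (AddCommGrpCat.of A)

variable {X}

lemma isSheaf_coarseTopology_iff (P : (Set X)ᵒᵖ ⥤ Type u) :
    Presieve.IsSheaf (coarseTopology X) P ↔ ∀ (U : Set X) (n : ℕ) (V : Fin n → Set X)
      (hV : IsCoarseCover U V),
      (Presieve.ofArrows V fun i ↦ homOfLE (hV.subset i)).IsSheafFor P := by
  refine (Presieve.isSheaf_pretopology (coarsePretopology X)).trans ⟨?_, ?_⟩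
  · exact fun h U n V hV ↦ h _ ⟨n, V, hV, rfl⟩
  · rintro h U _ ⟨n, V, hV, rfl⟩
    exact h U n V hV

end Site

/-! ### The inverse image functor -/

section InverseImage

variable {X Y : Type u} [MetricSpace X] [MetricSpace Y]

/-- The functor `U ↦ α(U)` on subsets. -/
abbrev imageFunctor (α : X → Y) : Set X ⥤ Set Y :=
  (Set.image_preimage (f := α)).monotone_l.functor

/-- The functor `V ↦ α⁻¹(V)` on subsets. -/
abbrev preimageFunctor (α : X → Y) : Set Y ⥤ Set X :=
  (Set.image_preimage (f := α)).monotone_u.functor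

lemma IsCoarseCover.preimage {α : X → Y} (hα : IsCoarse α) {U : Set Y} {n : ℕ}
    {V : Fin n → Set Y} (hV : IsCoarseCover U V) :
    IsCoarseCover (α ⁻¹' U) fun i ↦ α ⁻¹' V i := by
  refine isCoarseCover_iff.2 ⟨fun i ↦ Set.preimage_mono (hV.subset i), fun R ↦ ?_⟩
  obtain ⟨S, hS⟩ := hα.uniform R
  refine (hα.proper _ ((isCoarseCover_iff.1 hV).2 S)).subset ?_
  rintro x ⟨hx, hx'⟩
  refine ⟨hx, fun i ↦ ?_⟩
  obtain ⟨y, hy, hy', hxy⟩ := hx' i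
  exact ⟨α y, hy, hy', hS _ _ hxy⟩

lemma preimageFunctor_isContinuous {α : X → Y} (hα : IsCoarse α) :
    (preimageFunctor α).IsContinuous (coarseTopology Y) (coarseTopology X) := by
  have : (preimageFunctor α).IsRightAdjoint := (Set.image_preimage (f := α)).adjunction.isRightAdjoint
  refine Functor.isContinuous_of_coverPreserving (compatiblePreservingOfFlat _ _) ⟨?_⟩
  rintro U S ⟨_, ⟨n, V, hV, rfl⟩, hS⟩
  refine ⟨_, ⟨n, _, hV.preimage hα, rfl⟩, ?_⟩
  rintro _ _ ⟨i⟩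
  exact ⟨V i, homOfLE (hV.subset i), 𝟙 _, hS _ _ ⟨i⟩, rfl⟩

/-- The direct image functor `α_*`, with `(α_* F)(V) = F(α⁻¹(V))`. -/
def directImage {α : X → Y} (hα : IsCoarse α) : AbSheaf X ⥤ AbSheaf Y :=
  have := preimageFunctor_isContinuous hα
  (preimageFunctor α).sheafPushforwardContinuous AddCommGrpCat.{u} (coarseTopology Y)
    (coarseTopology X)

/-- The inverse image functor `α^*`: the sheaf `α^* G` is the sheafification of the presheaf
`U ↦ G(α(U))`. -/
def inverseImage (α : X → Y) : AbSheaf Y ⥤ AbSheaf X :=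
  sheafToPresheaf (coarseTopology Y) AddCommGrpCat.{u} ⋙
    (Functor.whiskeringLeft _ _ AddCommGrpCat.{u}).obj (imageFunctor α).op ⋙
      presheafToSheaf (coarseTopology X) AddCommGrpCat.{u}

/-- The adjunction of inverse and direct image. -/
def inverseDirectAdjunction {α : X → Y} (hα : IsCoarse α) :
    inverseImage α ⊣ directImage hα :=
  have := preimageFunctor_isContinuous hα
  (((Set.image_preimage (f := α)).adjunction.op.whiskerLeft AddCommGrpCat.{u}).comp
    (sheafificationAdjunction (coarseTopology X) AddCommGrpCat.{u})).restrictFullyFaithful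
    (fullyFaithfulSheafToPresheaf (coarseTopology Y) AddCommGrpCat.{u}) (Functor.FullyFaithful.id _)
    (Iso.refl _) (Iso.refl _)

instance (α : X → Y) : Limits.PreservesFiniteLimits (inverseImage α) := by
  unfold inverseImage
  infer_instance

end InverseImage

/-! ### The sheaves `CY_b^q( · , A)` -/

section CYSheaf

variable (X : Type u) [MetricSpace X] (A : Type u) [AddCommGroup A]

lemma isBlocky_pi {X : Type u} {q : ℕ} {κ : Type} [Finite κ] {B : κ → Type*}
    {φ : ∀ k, (Fin (q + 1) → X) → B k} (h : ∀ k, IsBlocky (φ k)) :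
    IsBlocky fun x k ↦ φ k x := by
  choose n p hp using h
  refine isBlocky_of_finite (κ := ∀ k, Fin (n k)) (fun x k ↦ p k x) fun x y hxy ↦ ?_
  exact funext fun k ↦ hp k x y fun i ↦ congrFun (hxy i) k

lemma isCocontrolled_image_inclusion {X : Type u} [MetricSpace X] {U V : Set X} (h : U ⊆ V) {q : ℕ}
    {C : Set (Fin (q + 1) → U)} (hC : IsCocontrolled C) :
    IsCocontrolled ((fun x ↦ Set.inclusion h ∘ x) '' C) := by
  intro R i
  obtain ⟨b, hb⟩ := Metric.isBounded_iff.1 (hC R i)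
  refine Metric.isBounded_iff.2 ⟨b, ?_⟩
  rintro _ ⟨_, ⟨⟨x, hx, rfl⟩, hxR⟩, rfl⟩ _ ⟨_, ⟨⟨y, hy, rfl⟩, hyR⟩, rfl⟩
  exact hb ⟨x, ⟨hx, hxR⟩, rfl⟩ ⟨y, ⟨hy, hyR⟩, rfl⟩

/-- The presheaf `U ↦ CY_b^q(U, A)` on `X_ct`. -/
def CYPresheaf (q : ℕ) : (Set X)ᵒᵖ ⥤ AddCommGrpCat.{u} where
  obj U := AddCommGrpCat.of (CY U.unop A q)
  map f := AddCommGrpCat.ofHom (CYMap A (isCoarse_inclusion (leOfHom f.unop)) q)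
  map_id U := by
    ext c
    rfl
  map_comp f g := by
    ext c
    rfl

variable {X A}

lemma CY_mk_eq_zero_iff {Z : Type u} [MetricSpace Z] {q : ℕ} (φ : blocky A Z q) :
    (QuotientAddGroup.mk φ : CY Z A q) = 0 ↔ IsCocontrolled (Function.support φ.1) :=
  QuotientAddGroup.eq_zero_iff φ

lemma CY_mk_eq_iff {Z : Type u} [MetricSpace Z] {q : ℕ} (φ ψ : blocky A Z q) :
    (QuotientAddGroup.mk φ : CY Z A q) = QuotientAddGroup.mk ψ ↔
      IsCocontrolled {x | φ.1 x ≠ ψ.1 x} := by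
  rw [← sub_eq_zero, ← QuotientAddGroup.mk_sub, CY_mk_eq_zero_iff]
  have : Function.support (φ - ψ).1 = {x | φ.1 x ≠ ψ.1 x} := by
    ext x
    exact sub_ne_zero
  rw [this]

lemma CY_identity {U : Set X} {n : ℕ} {V : Fin n → Set X} (hV : IsCoarseCover U V) {q : ℕ}
    (c : CY U A q) (hc : ∀ i, CYMap A (isCoarse_inclusion (hV.subset i)) q c = 0) : c = 0 := by
  obtain ⟨φ, rfl⟩ := QuotientAddGroup.mk_surjective c
  rw [CY_mk_eq_zero_iff]
  refine ((hV.isCocontrolled_compl q).union (isCocontrolled_iUnion fun i ↦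
    isCocontrolled_image_inclusion (hV.subset i) ((CY_mk_eq_zero_iff _).1 (hc i)))).mono ?_
  intro x hx
  by_cases h : ∀ i, ∃ j, (x j : X) ∉ V i
  · exact Or.inl h
  · push Not at h
    obtain ⟨i, hi⟩ := h
    exact Or.inr (Set.mem_iUnion.2 ⟨i, fun j ↦ ⟨x j, hi j⟩, hx, rfl⟩)

open Classical in
lemma exists_blocky_extension {X : Type u} {U V : Set X} (h : V ⊆ U) {q : ℕ} (φ : blocky A V q) :
    ∃ ψ : (Fin (q + 1) → U) → A, IsBlocky ψ ∧
      ∀ x : Fin (q + 1) → V, ψ (Set.inclusion h ∘ x) = φ.1 x := by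
  obtain ⟨φ, n, p, hp⟩ := φ
  refine ⟨fun x ↦ if hx : ∀ j, (x j : X) ∈ V then φ fun j ↦ ⟨x j, hx j⟩ else 0, ?_, ?_⟩
  · refine isBlocky_of_finite (κ := Option (Fin n))
      (fun u ↦ if hu : (u : X) ∈ V then some (p ⟨u, hu⟩) else none) fun x y hxy ↦ ?_
    have hmem (j) : (x j : X) ∈ V ↔ (y j : X) ∈ V := by
      have := hxy j
      by_cases h1 : (x j : X) ∈ V <;> by_cases h2 : (y j : X) ∈ V <;> simp_all
    by_cases hx : ∀ j, (x j : X) ∈ V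
    · have hy : ∀ j, (y j : X) ∈ V := fun j ↦ (hmem j).1 (hx j)
      simp only [hx, hy, implies_true, dite_true]
      refine hp _ _ fun j ↦ ?_
      have := hxy j
      simpa [hx j, hy j] using this
    · have hy : ¬ ∀ j, (y j : X) ∈ V := fun hy ↦ hx fun j ↦ (hmem j).2 (hy j)
      simp only [hx, hy, dite_false]
  · intro x
    have : ∀ j, ((Set.inclusion h ∘ x) j : X) ∈ V := fun j ↦ (x j).2
    simp only [this, implies_true, dite_true]
    rfl

open Classical in
lemma CY_gluing {U : Set X} {n : ℕ} {V : Fin n → Set X} (hV : IsCoarseCover U V) {q : ℕ}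
    (c : ∀ i, CY (V i) A q)
    (hc : ∀ i j, CYMap A (isCoarse_inclusion (Set.inter_subset_left : V i ∩ V j ⊆ V i)) q (c i) =
      CYMap A (isCoarse_inclusion (Set.inter_subset_right : V i ∩ V j ⊆ V j)) q (c j)) :
    ∃ t : CY U A q, ∀ i, CYMap A (isCoarse_inclusion (hV.subset i)) q t = c i := by
  choose φ hφ using fun i ↦ QuotientAddGroup.mk_surjective (c i)
  choose ψ hψ hψ' using fun i ↦ exists_blocky_extension (hV.subset i) (φ i)
  have hQ (i : Fin n) : IsBlocky fun x : Fin (q + 1) → U ↦ ∀ j, (x j : X) ∈ V i := by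
    refine isBlocky_of_finite (κ := Prop) (fun u : U ↦ (u : X) ∈ V i) fun x y hxy ↦ ?_
    exact propext (forall_congr' fun j ↦ iff_of_eq (hxy j))
  let F (v : Fin n → Prop × A) : A := if h : ∃ i, (v i).1 then (v h.choose).2 else 0
  have hF (v : Fin n → Prop × A) (h : ∃ i, (v i).1) : ∃ i, (v i).1 ∧ F v = (v i).2 :=
    ⟨h.choose, h.choose_spec, dif_pos h⟩
  let Φ : (Fin (q + 1) → U) → A := fun x ↦ F fun i ↦ (∀ j, (x j : X) ∈ V i, ψ i x)
  have hΦ : IsBlocky Φ := by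
    have h := isBlocky_pi fun i ↦ (hQ i).map₂ (hψ i) fun a b ↦ (a, b)
    exact h.map₂ h fun v _ ↦ F v
  refine ⟨QuotientAddGroup.mk ⟨Φ, hΦ⟩, fun k ↦ ?_⟩
  rw [← hφ k]
  refine (CY_mk_eq_iff _ _).2 ?_
  have hik (i : Fin n) : IsCocontrolled {x : Fin (q + 1) → ↥(V i ∩ V k) |
      (φ i).1 (Set.inclusion Set.inter_subset_left ∘ x) ≠
        (φ k).1 (Set.inclusion Set.inter_subset_right ∘ x)} := by
    have := hc i k
    rw [← hφ i, ← hφ k] at this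
    exact (CY_mk_eq_iff (blockyMap A _ q (φ i)) (blockyMap A _ q (φ k))).1 this
  refine (isCocontrolled_iUnion fun i ↦ isCocontrolled_image_inclusion
    (Set.inter_subset_right : V i ∩ V k ⊆ V k) (hik i)).mono ?_
  intro x hx
  obtain ⟨i, hi, hi'⟩ := hF (fun i ↦ (∀ j, ((Set.inclusion (hV.subset k) ∘ x) j : X) ∈ V i,
    ψ i (Set.inclusion (hV.subset k) ∘ x))) ⟨k, fun j ↦ (x j).2⟩
  refine Set.mem_iUnion.2 ⟨i, fun j ↦ ⟨x j, hi j, (x j).2⟩, ?_, rfl⟩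
  intro heq
  refine hx (hi'.trans (Eq.trans ?_ heq))
  exact hψ' i fun j ↦ ⟨x j, hi j⟩

variable (X A)

lemma CYPresheaf_isSheaf (q : ℕ) :
    Presheaf.IsSheaf (coarseTopology X) (CYPresheaf X A q) := by
  rw [Presheaf.isSheaf_iff_isSheaf_forget (coarseTopology X) (CYPresheaf X A q)
    (forget AddCommGrpCat.{u}), isSheaf_iff_isSheaf_of_type, isSheaf_coarseTopology_iff]
  intro U n V hV
  rw [Presieve.isSheafFor_arrows_iff]
  intro c hc
  obtain ⟨t, ht⟩ := CY_gluing hV c fun i j ↦ hc i j (V i ∩ V j) (homOfLE Set.inter_subset_left)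
    (homOfLE Set.inter_subset_right) (Subsingleton.elim _ _)
  refine ⟨t, ht, fun s hs ↦ ?_⟩
  let s' : CY U A q := s
  refine sub_eq_zero.1 (CY_identity hV (s' - t) fun i ↦ ?_)
  rw [map_sub, sub_eq_zero]
  exact (hs i).trans (ht i).symm

/-- The sheaf `CY_b^q( · , A)` on `X_ct`. -/
def CYSheaf (q : ℕ) : AbSheaf X := ⟨CYPresheaf X A q, CYPresheaf_isSheaf X A q⟩

/-- The differential `CY_b^q( · , A) → CY_b^{q + 1}( · , A)`. -/
def CYSheafD (q : ℕ) : CYSheaf X A q ⟶ CYSheaf X A (q + 1) where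
  hom :=
    { app := fun U ↦ AddCommGrpCat.ofHom (CYd U.unop A q)
      naturality := fun _ _ f ↦ by
        ext c
        exact (CYMap_CYd A (isCoarse_inclusion (leOfHom f.unop)) q c).symm }

/-- The complex of sheaves `CY_b^*( · , A)` on `X_ct`. -/
def CYSheafComplex : CochainComplex (AbSheaf X) ℕ :=
  CochainComplex.of (CYSheaf X A) (CYSheafD X A) fun q ↦ by
    ext U c
    exact CYd_CYd U.unop A q c

/-- The map `A → CY_b^0(Z, A)` sending `a` to the class of the constant function `a`. -/
def constToCY (Z : Type u) [MetricSpace Z] : A →+ CY Z A 0 :=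
  (QuotientAddGroup.mk' _).comp
    { toFun := fun a ↦ (⟨fun _ ↦ a, isBlocky_const a⟩ : blocky A Z 0)
      map_zero' := rfl
      map_add' := fun _ _ ↦ rfl }

lemma CYd_constToCY (Z : Type u) [MetricSpace Z] (a : A) : CYd Z A 0 (constToCY A Z a) = 0 := by
  refine congrArg QuotientAddGroup.mk (Subtype.ext (funext fun x ↦ ?_) :
    blockyD A Z 0 ⟨fun _ ↦ a, isBlocky_const a⟩ = 0)
  rw [blockyD_apply]
  simp [Fin.sum_univ_two]

/-- The inclusion of constant functions as a morphism from the constant presheaf. -/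
def constToCYPresheaf : (Functor.const (Set X)ᵒᵖ).obj (AddCommGrpCat.of A) ⟶ CYPresheaf X A 0 where
  app U := AddCommGrpCat.ofHom (constToCY A U.unop)
  naturality _ _ _ := rfl

/-- The morphism `A_X → CY_b^0( · , A)` induced by the inclusion of constant functions. -/
def constToCYSheaf : constSheaf X A ⟶ CYSheaf X A 0 :=
  ((sheafificationAdjunction (coarseTopology X) AddCommGrpCat.{u}).homEquiv _ (CYSheaf X A 0)).symm
    (constToCYPresheaf X A)

lemma constToCYSheaf_comp : constToCYSheaf X A ≫ CYSheafD X A 0 = 0 := by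
  have h : constToCYPresheaf X A ≫ (CYSheafD X A 0).hom = 0 := by
    ext U a
    exact CYd_constToCY A U.unop a
  refine ((sheafificationAdjunction (coarseTopology X)
    AddCommGrpCat.{u}).homEquiv_naturality_right_symm (constToCYPresheaf X A)
      (CYSheafD X A 0)).symm.trans ?_
  refine (congrArg _ h).trans ?_
  refine (Adjunction.homEquiv_counit _ _ _ _).trans ?_
  exact (congrArg (· ≫ _) (Functor.map_zero _ _ _)).trans Limits.zero_comp

/-- The augmentation `A_X → CY_b^*( · , A)`, where `A_X` is placed in degree `0`. -/
def CYAugmentation : (CochainComplex.single₀ (AbSheaf X)).obj (constSheaf X A) ⟶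
    CYSheafComplex X A :=
  (CochainComplex.fromSingle₀Equiv _ _).symm ⟨constToCYSheaf X A,
    (congrArg (constToCYSheaf X A ≫ ·) (CochainComplex.of_d (CYSheaf X A) (CYSheafD X A) 0)).trans
      (constToCYSheaf_comp X A)⟩

end CYSheaf

/-! ### Comparison of a resolution with the right derived functors -/

section Comparison

variable {C : Type*} [Category* C] [Abelian C]

lemma resolution_exact_succ {F : C} {K : CochainComplex C ℕ}
    (ε : (CochainComplex.single₀ C).obj F ⟶ K) [QuasiIso ε] (n : ℕ) :
    (ShortComplex.mk _ _ (K.d_comp_d n (n + 1) (n + 2))).Exact := by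
  have h : K.ExactAt (n + 1) := by
    rw [← quasiIsoAt_iff_exactAt ε (n + 1) (CochainComplex.exactAt_succ_single_obj _ _)]
    infer_instance
  exact (HomologicalComplex.exactAt_iff' _ n (n + 1) (n + 2) (by simp)
    (by simp only [CochainComplex.next]; rfl)).1 h

lemma resolution_comp_d {F : C} {K : CochainComplex C ℕ}
    (ε : (CochainComplex.single₀ C).obj F ⟶ K) : ε.f 0 ≫ K.d 0 1 = 0 := by
  rw [ε.comm, HomologicalComplex.single_obj_d, Limits.zero_comp]

lemma resolution_exact_zero {F : C} {K : CochainComplex C ℕ}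
    (ε : (CochainComplex.single₀ C).obj F ⟶ K) [QuasiIso ε] :
    (ShortComplex.mk _ _ (resolution_comp_d ε)).Exact ∧ Mono (ε.f 0) := by
  have h : QuasiIsoAt ε 0 := inferInstance
  rw [CochainComplex.quasiIsoAt₀_iff] at h
  exact (ShortComplex.quasiIso_iff_of_zeros _ (HomologicalComplex.single_obj_d (.up ℕ) _ _ _ _)
    (HomologicalComplex.single_obj_d (.up ℕ) _ _ _ _) (K.shape _ _ (by simp))).1 h

lemma exists_lift_of_resolution {F : C} {K : CochainComplex C ℕ}
    (ε : (CochainComplex.single₀ C).obj F ⟶ K) [QuasiIso ε] (I : InjectiveResolution F) :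
    ∃ φ : K ⟶ I.cocomplex, ε ≫ φ = I.ι := by
  obtain ⟨h0, hm⟩ := resolution_exact_zero ε
  let f0 : K.X 0 ⟶ I.cocomplex.X 0 := Injective.factorThru (I.ι.f 0) (ε.f 0)
  have hf0 : ε.f 0 ≫ f0 = I.ι.f 0 := Injective.comp_factorThru _ _
  let f1 : K.X 1 ⟶ I.cocomplex.X 1 := h0.descToInjective (f0 ≫ I.cocomplex.d 0 1) (by
    rw [← Category.assoc]
    exact (congrArg (· ≫ _) hf0).trans I.ι_f_zero_comp_complex_d)
  have hf1 : K.d 0 1 ≫ f1 = f0 ≫ I.cocomplex.d 0 1 := h0.comp_descToInjective _ _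
  let φ : K ⟶ I.cocomplex := CochainComplex.mkHom _ _ f0 f1 hf1.symm fun n ⟨g, g', w⟩ ↦
    ⟨(resolution_exact_succ ε n).descToInjective (g' ≫ I.cocomplex.d (n + 1) (n + 2))
      (by simp [reassoc_of% w.symm]),
      ((resolution_exact_succ ε n).comp_descToInjective _ _).symm⟩
  refine ⟨φ, ?_⟩
  ext
  exact hf0

variable {D : Type*} [Category* D] [Abelian D] [HasInjectiveResolutions C]

/-- Let `F → K` be a resolution of `F` and let `F → I` be an injective resolution. There is
a morphism of complexes `φ : K → I` (unique up to homotopy) which is compatible with the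
augmentations. It induces the canonical map `H^q(Γ K) → H^q(Γ I) = R^q Γ (F)`. -/
def resolutionComparison (Γ : C ⥤ D) [Γ.Additive] {F : C} {K : CochainComplex C ℕ}
    (ε : (CochainComplex.single₀ C).obj F ⟶ K) [QuasiIso ε] (q : ℕ) :
    ((Γ.mapHomologicalComplex (ComplexShape.up ℕ)).obj K).homology q ⟶ (Γ.rightDerived q).obj F :=
  HomologicalComplex.homologyMap ((Γ.mapHomologicalComplex (ComplexShape.up ℕ)).map
      (exists_lift_of_resolution ε (injectiveResolution F)).choose) q ≫
    ((injectiveResolution F).isoRightDerivedObj Γ q).inv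

end Comparison

/-! ### The two maps induced by a coarse map -/

section Cohomology

variable {X Y : Type u} [MetricSpace X] [MetricSpace Y]

instance (α : X → Y) : (inverseImage α).Additive := by
  unfold inverseImage
  infer_instance

lemma inverseImage_preservesHomology {α : X → Y} (hα : IsCoarse α) :
    (inverseImage α).PreservesHomology := by
  have := (inverseDirectAdjunction hα).leftAdjoint_preservesColimits
  infer_instance

/-- The pullback of global sections, `G(Y) = (α_* α^* G)(Y) → (α^* G)(X)`, given by the unit
of the adjunction of `α^*` and `α_*`. -/
def globalSectionsPullback {α : X → Y} (hα : IsCoarse α) :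
    globalSections Y ⟶ inverseImage α ⋙ globalSections X :=
  Functor.whiskerRight (inverseDirectAdjunction hα).unit (globalSections Y)

/-- The functor `α^*`, applied to the resolution `G → K` of a sheaf `G` on `Y_ct`. -/
def inverseImageResolution (α : X → Y) {G : AbSheaf Y} {K : CochainComplex (AbSheaf Y) ℕ}
    (ε : (CochainComplex.single₀ (AbSheaf Y)).obj G ⟶ K) :
    (CochainComplex.single₀ (AbSheaf X)).obj ((inverseImage α).obj G) ⟶
      ((inverseImage α).mapHomologicalComplex (ComplexShape.up ℕ)).obj K :=
  (HomologicalComplex.singleMapHomologicalComplex (inverseImage α) (ComplexShape.up ℕ) 0).inv.app G ≫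
    ((inverseImage α).mapHomologicalComplex (ComplexShape.up ℕ)).map ε

lemma inverseImageResolution_quasiIso {α : X → Y} (hα : IsCoarse α) {G : AbSheaf Y}
    {K : CochainComplex (AbSheaf Y) ℕ}
    (ε : (CochainComplex.single₀ (AbSheaf Y)).obj G ⟶ K) [QuasiIso ε] :
    QuasiIso (inverseImageResolution α ε) := by
  have := inverseImage_preservesHomology hα
  unfold inverseImageResolution
  infer_instance

/-- The map `H_ct^q(Y, G) → H_ct^q(X, α^* G)` induced by the inverse image functor. If `G → I` is
an injective resolution, then `α^* G → α^* I` is a resolution since `α^*` is exact, and the map is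
the composite
`H_ct^q(Y, G) = H^q(Γ(Y, I)) → H^q(Γ(X, α^* I)) → H_ct^q(X, α^* G)`. -/
def inverseImageCohomology {α : X → Y} (hα : IsCoarse α) (G : AbSheaf Y) (q : ℕ) :
    cohomology Y G q ⟶ cohomology X ((inverseImage α).obj G) q :=
  have := inverseImageResolution_quasiIso hα (injectiveResolution G).ι
  ((injectiveResolution G).isoRightDerivedObj (globalSections Y) q).hom ≫
    HomologicalComplex.homologyMap ((NatTrans.mapHomologicalComplex (globalSectionsPullback hα)
      (ComplexShape.up ℕ)).app (injectiveResolution G).cocomplex) q ≫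
    resolutionComparison (globalSections X)
      (inverseImageResolution α (injectiveResolution G).ι) q

/-- The canonical isomorphism `α^* A_Y ≅ A_X`. Both functors `A ↦ α^* A_Y` and `A ↦ A_X` are left
adjoint to the functor of global sections on `X_ct`, because `(α_* F)(Y) = F(X)`. -/
def inverseImageConst {α : X → Y} (hα : IsCoarse α) (A : Type u) [AddCommGroup A] :
    (inverseImage α).obj (constSheaf Y A) ≅ constSheaf X A :=
  (((constantSheafAdj (coarseTopology Y) AddCommGrpCat.{u}
      (Preorder.isTerminalTop (Set Y))).comp (inverseDirectAdjunction hα)).leftAdjointUniq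
    (constantSheafAdj (coarseTopology X) AddCommGrpCat.{u}
      (Preorder.isTerminalTop (Set X)))).app (AddCommGrpCat.of A)

/-- The map `α^* : H_ct^q(Y, A_Y) → H_ct^q(X, α^* A_Y) = H_ct^q(X, A_X)` induced by the inverse
image functor. -/
def constCohomologyMap {α : X → Y} (hα : IsCoarse α) (A : Type u) [AddCommGroup A] (q : ℕ) :
    cohomology Y (constSheaf Y A) q ⟶ cohomology X (constSheaf X A) q :=
  inverseImageCohomology hα (constSheaf Y A) q ≫
    ((globalSections X).rightDerived q).map (inverseImageConst hα A).hom

variable (X) (A : Type u) [AddCommGroup A]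

/-- Restriction of cochains from `X` to its largest subset, as a map from `CY_b^*(X, A)` to the
global sections of the complex of sheaves `CY_b^*( · , A)`. -/
def CYToGlobalSections : CYComplex X A ⟶
    ((globalSections X).mapHomologicalComplex (ComplexShape.up ℕ)).obj (CYSheafComplex X A) :=
  CochainComplex.ofHom
    (fun q ↦ AddCommGrpCat.ofHom (CYMap A (isCoarse_val (⊤ : Set X)) q)) fun q ↦ by
    have h1 : (CYComplex X A).d q (q + 1) = AddCommGrpCat.ofHom (CYd X A q) :=
      CochainComplex.of_d (fun q ↦ AddCommGrpCat.of (CY X A q))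
        (fun q ↦ AddCommGrpCat.ofHom (CYd X A q)) q
    have h2 : (CYSheafComplex X A).d q (q + 1) = CYSheafD X A q :=
      CochainComplex.of_d (CYSheaf X A) _ q
    rw [h1, Functor.mapHomologicalComplex_obj_d, h2]
    ext c
    exact (CYMap_CYd A (isCoarse_val (⊤ : Set X)) q c).symm

/-- The canonical map `HY_b^q(X, A) → H_ct^q(X, A_X)` given by the fact (argument `h`) that
`A_X → CY_b^*( · , A)` is a resolution. -/
def HYComparison (h : QuasiIso (CYAugmentation X A)) (q : ℕ) :
    HY X A q ⟶ cohomology X (constSheaf X A) q :=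
  HomologicalComplex.homologyMap (CYToGlobalSections X A) q ≫
    resolutionComparison (globalSections X) (CYAugmentation X A) q

end Cohomology

end CoarseSheaf

end

noncomputable section

namespace CoarseSheaf

section LocalVanishing

variable {X : Type u} [MetricSpace X] {A : Type u} [AddCommGroup A]

lemma exists_isCoarseCover_of_finite {κ : Type*} [Finite κ] {U : Set X} (V : κ → Set X)
    (hV : ∀ i, V i ⊆ U)
    (h : ∀ R : ℝ, Bornology.IsBounded {x | x ∈ U ∧ ∀ i, ∃ y ∈ U, y ∉ V i ∧ dist x y ≤ R}) :
    ∃ (n : ℕ) (e : Fin n → κ), IsCoarseCover U (V ∘ e) := by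
  obtain ⟨n, ⟨e⟩⟩ := Finite.exists_equiv_fin κ
  refine ⟨n, e.symm, isCoarseCover_iff.2 ⟨fun i ↦ hV _, fun R ↦ (h R).subset ?_⟩⟩
  rintro x ⟨hx, hx'⟩
  exact ⟨hx, fun i ↦ by simpa using hx' (e i)⟩

/-- A blocky function with cocontrolled support vanishes on the members of a coarse cover. -/
lemma exists_isCoarseCover_eq_zero {U : Set X} {q : ℕ} {φ : (Fin (q + 1) → U) → A}
    (hφ : IsBlocky φ) (h : IsCocontrolled (Function.support φ)) :
    ∃ (n : ℕ) (V : Fin n → Set X) (hV : IsCoarseCover U V),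
      ∀ (i : Fin n) (x : Fin (q + 1) → V i), φ (Set.inclusion (hV.subset i) ∘ x) = 0 := by
  obtain ⟨n, p, hp⟩ := hφ
  let κ := {S : Finset (Fin n) // ∀ x : Fin (q + 1) → U, (∀ j, p (x j) ∈ S) → φ x = 0}
  let V : κ → Set X := fun S ↦ {x | ∃ hx : x ∈ U, p ⟨x, hx⟩ ∈ S.1}
  obtain ⟨m, e, hV⟩ := exists_isCoarseCover_of_finite (U := U) V (fun S x hx ↦ hx.1) (by
    intro R
    obtain ⟨b, hb⟩ := Metric.isBounded_iff.1 (h (R + R) 0)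
    refine Metric.isBounded_iff.2 ⟨R + b + R, ?_⟩
    have key : ∀ x : X, x ∈ U → (∀ i, ∃ y ∈ U, y ∉ V i ∧ dist x y ≤ R) →
        ∃ z ∈ Function.support φ ∩ vietorisRips U q (R + R), dist x (z 0) ≤ R := by
      classical
      intro x hx hx'
      let T : Finset (Fin n) := {k | ∃ y : U, p y = k ∧ dist x y ≤ R}
      have hT : ¬ ∀ y : Fin (q + 1) → U, (∀ j, p (y j) ∈ T) → φ y = 0 := fun hT ↦ by
        obtain ⟨y, hy, hyT, hxy⟩ := hx' ⟨T, hT⟩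
        exact hyT ⟨hy, by simpa [T] using ⟨y, ⟨hy, rfl⟩, hxy⟩⟩
      push Not at hT
      obtain ⟨y, hyT, hy⟩ := hT
      have hz : ∀ j, ∃ z : U, p z = p (y j) ∧ dist x z ≤ R := fun j ↦ by
        simpa [T] using hyT j
      choose z hz hxz using hz
      refine ⟨z, ⟨?_, fun i j ↦ ?_⟩, hxz 0⟩
      · rw [Function.mem_support, hp z y hz]
        exact hy
      · have h1 := dist_triangle_left (z i : X) (z j) x
        exact h1.trans (add_le_add (hxz i) (hxz j))
    rintro x ⟨hx, hx'⟩ y ⟨hy, hy'⟩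
    obtain ⟨z, hz, hxz⟩ := key x hx hx'
    obtain ⟨w, hw, hyw⟩ := key y hy hy'
    have h1 : dist (z 0 : X) (w 0) ≤ b := hb ⟨z, hz, rfl⟩ ⟨w, hw, rfl⟩
    have h2 := dist_triangle4 x (z 0) (w 0) y
    rw [dist_comm (w 0 : X) y] at h2
    linarith)
  refine ⟨m, V ∘ e, hV, fun i x ↦ (e i).2 _ fun j ↦ ?_⟩
  obtain ⟨hx, hx'⟩ := (x j).2
  exact hx'

lemma exists_blockyD_eq {Z : Type u} (q : ℕ) (φ : blocky A Z (q + 1))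
    (h : blockyD A Z (q + 1) φ = 0) : ∃ ψ, blockyD A Z q ψ = φ := by
  rcases isEmpty_or_nonempty Z with hZ | ⟨⟨z⟩⟩
  · exact ⟨0, Subtype.ext (funext fun x ↦ isEmptyElim (x 0))⟩
  · have hψ : IsBlocky fun x : Fin (q + 1) → Z ↦ φ.1 (Fin.cons z x) := by
      obtain ⟨n, p, hp⟩ := φ.2
      refine ⟨n, p, fun x y hxy ↦ hp _ _ fun i ↦ ?_⟩
      refine Fin.cases rfl (fun j ↦ ?_) i
      simpa using hxy j
    refine ⟨⟨_, hψ⟩, Subtype.ext (funext fun x ↦ ?_)⟩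
    have h1 := congrFun (congrArg Subtype.val h) (Fin.cons z x)
    rw [blockyD_apply, Fin.sum_univ_succ] at h1
    have h2 (k : Fin (q + 2)) : (Fin.cons z x : Fin (q + 3) → Z) ∘ k.succ.succAbove =
        Fin.cons z (x ∘ k.succAbove) := by
      funext j
      refine Fin.cases (by simp) (fun j ↦ by simp) j
    have h3 : (Fin.cons z x : Fin (q + 3) → Z) ∘ (0 : Fin (q + 3)).succAbove = x := by
      funext j
      simp
    simp only [h2, h3, Fin.val_succ, pow_succ, Fin.val_zero, pow_zero, one_smul, mul_neg_one,
      neg_smul, Finset.sum_neg_distrib] at h1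
    rw [blockyD_apply]
    exact (sub_eq_zero.1 ((sub_eq_add_neg _ _).trans h1)).symm

lemma exists_blocky_const_eq {Z : Type u} (φ : blocky A Z 0)
    (h : blockyD A Z 0 φ = 0) : ∃ a : A, ∀ x, φ.1 x = a := by
  rcases isEmpty_or_nonempty Z with hZ | ⟨⟨z⟩⟩
  · exact ⟨0, fun x ↦ isEmptyElim (x 0)⟩
  · refine ⟨φ.1 fun _ ↦ z, fun x ↦ ?_⟩
    have h1 := congrFun (congrArg Subtype.val h) ![z, x 0]
    rw [blockyD_apply, Fin.sum_univ_two] at h1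
    have h2 : (![z, x 0] : Fin 2 → Z) ∘ (0 : Fin 2).succAbove = x := by
      funext j
      obtain rfl := Subsingleton.elim j 0
      simp
    have h3 : (![z, x 0] : Fin 2 → Z) ∘ (1 : Fin 2).succAbove = fun _ ↦ z := by
      funext j
      obtain rfl := Subsingleton.elim j 0
      simp
    rw [h2, h3] at h1
    simp only [Fin.val_zero, pow_zero, one_smul, Fin.val_one, pow_one, neg_smul] at h1
    exact sub_eq_zero.1 ((sub_eq_add_neg _ _).trans h1)

lemma exists_isCoarseCover_blockyD_eq_zero {U : Set X} {q : ℕ} (c : CY U A q)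
    (hc : CYd U A q c = 0) : ∃ (n : ℕ) (V : Fin n → Set X) (hV : IsCoarseCover U V),
      ∀ i, ∃ φ : blocky A (V i) q, blockyD A (V i) q φ = 0 ∧
        CYMap A (isCoarse_inclusion (hV.subset i)) q c = QuotientAddGroup.mk φ := by
  obtain ⟨φ, rfl⟩ := QuotientAddGroup.mk_surjective c
  have h := (CY_mk_eq_zero_iff (blockyD A U q φ)).1 hc
  obtain ⟨n, V, hV, h⟩ := exists_isCoarseCover_eq_zero (blockyD A U q φ).2 h
  refine ⟨n, V, hV, fun i ↦ ⟨blockyMap A (Set.inclusion (hV.subset i)) q φ, ?_, rfl⟩⟩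
  refine Subtype.ext (funext fun x ↦ (Eq.trans ?_ (h i x)))
  rw [blockyD_apply, blockyD_apply]
  rfl

lemma CY_locally_exact {U : Set X} {q : ℕ} (c : CY U A (q + 1)) (hc : CYd U A (q + 1) c = 0) :
    ∃ (n : ℕ) (V : Fin n → Set X) (hV : IsCoarseCover U V),
      ∀ i, ∃ t, CYd (V i) A q t = CYMap A (isCoarse_inclusion (hV.subset i)) (q + 1) c := by
  obtain ⟨n, V, hV, h⟩ := exists_isCoarseCover_blockyD_eq_zero c hc
  refine ⟨n, V, hV, fun i ↦ ?_⟩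
  obtain ⟨φ, hφ, hφ'⟩ := h i
  obtain ⟨ψ, rfl⟩ := exists_blockyD_eq q φ hφ
  exact ⟨QuotientAddGroup.mk ψ, hφ'.symm⟩

lemma CY_locally_const {U : Set X} (c : CY U A 0) (hc : CYd U A 0 c = 0) :
    ∃ (n : ℕ) (V : Fin n → Set X) (hV : IsCoarseCover U V),
      ∀ i, ∃ a, constToCY A (V i) a = CYMap A (isCoarse_inclusion (hV.subset i)) 0 c := by
  obtain ⟨n, V, hV, h⟩ := exists_isCoarseCover_blockyD_eq_zero c hc
  refine ⟨n, V, hV, fun i ↦ ?_⟩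
  obtain ⟨φ, hφ, hφ'⟩ := h i
  obtain ⟨a, ha⟩ := exists_blocky_const_eq φ hφ
  refine ⟨a, Eq.trans ?_ hφ'.symm⟩
  exact congrArg QuotientAddGroup.mk (Subtype.ext (funext fun x ↦ (ha x).symm))

lemma isCoarseCover_empty_of_constToCY_eq_zero {U : Set X} {a : A} (ha : a ≠ 0)
    (h : constToCY A U a = 0) : IsCoarseCover U (Fin.elim0 : Fin 0 → Set X) := by
  refine isCoarseCover_iff.2 ⟨fun i ↦ i.elim0, fun _ ↦ ?_⟩
  have h1 := (CY_mk_eq_zero_iff (⟨fun _ ↦ a, isBlocky_const a⟩ : blocky A U 0)).1 h 0 0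
  obtain ⟨b, hb⟩ := Metric.isBounded_iff.1 h1
  refine Metric.isBounded_iff.2 ⟨b, fun x hx y hy ↦ ?_⟩
  exact hb ⟨fun _ ↦ ⟨x, hx.1⟩, ⟨ha, fun _ _ ↦ by simp⟩, rfl⟩
    ⟨fun _ ↦ ⟨y, hy.1⟩, ⟨ha, fun _ _ ↦ by simp⟩, rfl⟩

end LocalVanishing

/-- Short complexes in an abelian category. -/
abbrev AbelianShortComplex (C : Type*) [Category* C] [Abelian C] := ShortComplex C

section Sections

variable {X : Type u} [MetricSpace X]

/-- The group of sections `F(U)`. -/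
abbrev Sec (F : AbSheaf X) (U : Set X) : Type u := F.obj.obj (op U)

/-- The restriction `F(U) → F(V)`. -/
def res (F : AbSheaf X) {U V : Set X} (h : V ⊆ U) : Sec F U →+ Sec F V :=
  (F.obj.map (homOfLE h).op).hom

/-- The map `F(U) → G(U)` of a morphism of sheaves. -/
def onSec {F G : AbSheaf X} (f : F ⟶ G) (U : Set X) : Sec F U →+ Sec G U :=
  (f.hom.app (op U)).hom

@[simp]
lemma res_self (F : AbSheaf X) {U : Set X} (h : U ⊆ U) (s : Sec F U) : res F h s = s := by
  simp [res]

@[simp]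
lemma res_res (F : AbSheaf X) {U V W : Set X} (h : V ⊆ U) (h' : W ⊆ V) (s : Sec F U) :
    res F h' (res F h s) = res F (h'.trans h) s := by
  have : (homOfLE (h'.trans h)).op = (homOfLE h).op ≫ (homOfLE h').op := rfl
  simp [res, this]

lemma onSec_res {F G : AbSheaf X} (f : F ⟶ G) {U V : Set X} (h : V ⊆ U) (s : Sec F U) :
    onSec f V (res F h s) = res G h (onSec f U s) :=
  NatTrans.naturality_apply f.hom (homOfLE h).op s

@[simp]
lemma onSec_comp {F G H : AbSheaf X} (f : F ⟶ G) (g : G ⟶ H) {U : Set X} (s : Sec F U) :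
    onSec (f ≫ g) U s = onSec g U (onSec f U s) := rfl

@[simp]
lemma onSec_zero {F G : AbSheaf X} {U : Set X} (s : Sec F U) :
    onSec (0 : F ⟶ G) U s = 0 := rfl

lemma sec_isSheafFor (F : AbSheaf X) {U : Set X} {n : ℕ} {V : Fin n → Set X}
    (hV : IsCoarseCover U V) :
    (Presieve.ofArrows V fun i ↦ homOfLE (hV.subset i)).IsSheafFor
      (F.obj ⋙ forget AddCommGrpCat.{u}) :=
  (isSheaf_coarseTopology_iff _).1 ((isSheaf_iff_isSheaf_of_type _ _).1
    ((Presheaf.isSheaf_iff_isSheaf_forget (coarseTopology X) F.obj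
      (forget AddCommGrpCat.{u})).1 F.property)) U n V hV

lemma sec_ext (F : AbSheaf X) {U : Set X} {n : ℕ} {V : Fin n → Set X}
    (hV : IsCoarseCover U V) {s t : Sec F U}
    (h : ∀ i, res F (hV.subset i) s = res F (hV.subset i) t) : s = t := by
  refine (sec_isSheafFor F hV).isSeparatedFor.ext ?_
  rintro W f ⟨i⟩
  exact h i

/-- The families of sections on the `V i` which agree on the intersections. -/
def IsCompatible (F : AbSheaf X) {n : ℕ} {V : Fin n → Set X} (c : ∀ i, Sec F (V i)) : Prop :=
  ∀ i j, res F (Set.inter_subset_left : V i ∩ V j ⊆ V i) (c i) =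
    res F (Set.inter_subset_right : V i ∩ V j ⊆ V j) (c j)

lemma IsCompatible.res_eq {F : AbSheaf X} {n : ℕ} {V : Fin n → Set X} {c : ∀ i, Sec F (V i)}
    (h : IsCompatible F c) {i j : Fin n} {W : Set X} (hi : W ⊆ V i) (hj : W ⊆ V j) :
    res F hi (c i) = res F hj (c j) := by
  have := congrArg (res F (Set.subset_inter hi hj)) (h i j)
  simpa using this

lemma IsCompatible.onSec {F G : AbSheaf X} (f : F ⟶ G) {n : ℕ} {V : Fin n → Set X}
    {c : ∀ i, Sec F (V i)} (h : IsCompatible F c) :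
    IsCompatible G fun i ↦ onSec f (V i) (c i) := fun i j ↦ by
  rw [← onSec_res, ← onSec_res, h i j]

lemma sec_glue (F : AbSheaf X) {U : Set X} {n : ℕ} {V : Fin n → Set X}
    (hV : IsCoarseCover U V) (c : ∀ i, Sec F (V i)) (hc : IsCompatible F c) :
    ∃ s : Sec F U, ∀ i, res F (hV.subset i) s = c i := by
  obtain ⟨t, ht, -⟩ := (Presieve.isSheafFor_arrows_iff _ _).1 (sec_isSheafFor F hV) c
    (fun i j W f g _ ↦ hc.res_eq (leOfHom f) (leOfHom g))
  exact ⟨t, ht⟩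

lemma mem_coarseTopology_iff {U : Set X} (S : Sieve U) : S ∈ coarseTopology X U ↔
    ∃ (n : ℕ) (V : Fin n → Set X) (hV : IsCoarseCover U V),
      ∀ i, S (homOfLE (hV.subset i)) := by
  refine (Pretopology.mem_toGrothendieck (coarsePretopology X) U S).trans ⟨?_, ?_⟩
  · rintro ⟨_, ⟨n, V, hV, rfl⟩, h⟩
    exact ⟨n, V, hV, fun i ↦ h _ _ ⟨i⟩⟩
  · rintro ⟨n, V, hV, h⟩
    refine ⟨_, ⟨n, V, hV, rfl⟩, ?_⟩
    rintro _ _ ⟨i⟩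
    exact h i

lemma epi_iff_locally_surjective {F G : AbSheaf X} (f : F ⟶ G) : Epi f ↔
    ∀ (U : Set X) (s : Sec G U), ∃ (n : ℕ) (V : Fin n → Set X) (hV : IsCoarseCover U V),
      ∀ i, ∃ t, onSec f (V i) t = res G (hV.subset i) s := by
  rw [← Sheaf.isLocallySurjective_iff_epi' AddCommGrpCat.{u} f]
  constructor
  · intro h U s
    exact (mem_coarseTopology_iff _).1 (h.imageSieve_mem s)
  · exact fun h ↦ ⟨fun {U} s ↦ (mem_coarseTopology_iff _).2 (h U s)⟩

instance (U : Set X) : Limits.PreservesFiniteLimits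
    ((sheafSections (coarseTopology X) AddCommGrpCat.{u}).obj (op U)) :=
  inferInstanceAs (Limits.PreservesFiniteLimits (sheafToPresheaf (coarseTopology X) _ ⋙
    (evaluation _ AddCommGrpCat.{u}).obj (op U)))

instance (U : Set X) :
    ((sheafSections (coarseTopology X) AddCommGrpCat.{u}).obj (op U)).Additive where

lemma exists_cycles_section (S : AbelianShortComplex (AbSheaf X)) {U : Set X} (s : Sec S.X₂ U)
    (hs : onSec S.g U s = 0) : ∃ t, onSec S.iCycles U t = s := by
  let Γ := (sheafSections (coarseTopology X) AddCommGrpCat.{u}).obj (op U)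
  have h : (ShortComplex.mk S.iCycles S.g S.iCycles_g).Exact :=
    ShortComplex.exact_of_f_is_kernel _ S.cyclesIsKernel
  have h' := h.map_of_mono_of_preservesKernel Γ inferInstance inferInstance
  exact (ShortComplex.ab_exact_iff _).1 h' s hs

lemma onSec_injective {F G : AbSheaf X} (f : F ⟶ G) [Mono f] (U : Set X) :
    Function.Injective (onSec f U) :=
  (AddCommGrpCat.mono_iff_injective _).1
    (((sheafSections (coarseTopology X) AddCommGrpCat.{u}).obj (op U)).map_mono f)

/-- Exactness of sheaves is local exactness on sections. -/
lemma exact_iff_locally_exact (S : AbelianShortComplex (AbSheaf X)) : S.Exact ↔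
    ∀ (U : Set X) (s : Sec S.X₂ U), onSec S.g U s = 0 →
      ∃ (n : ℕ) (V : Fin n → Set X) (hV : IsCoarseCover U V),
        ∀ i, ∃ t, onSec S.f (V i) t = res S.X₂ (hV.subset i) s := by
  rw [ShortComplex.exact_iff_epi_toCycles, epi_iff_locally_surjective]
  have hf {U : Set X} (t : Sec S.X₁ U) :
      onSec S.iCycles U (onSec S.toCycles U t) = onSec S.f U t := by
    rw [← onSec_comp, S.toCycles_i]
  constructor
  · intro h U s hs
    obtain ⟨t, rfl⟩ := exists_cycles_section S s hs
    obtain ⟨n, V, hV, h⟩ := h U t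
    refine ⟨n, V, hV, fun i ↦ ?_⟩
    obtain ⟨r, hr⟩ := h i
    exact ⟨r, by rw [← hf, hr, onSec_res]⟩
  · intro h U s
    obtain ⟨n, V, hV, h⟩ := h U (onSec S.iCycles U s) (by
      rw [← onSec_comp, S.iCycles_g, onSec_zero])
    refine ⟨n, V, hV, fun i ↦ ?_⟩
    obtain ⟨r, hr⟩ := h i
    exact ⟨r, onSec_injective S.iCycles _ (by rw [hf, hr, onSec_res])⟩

end Sections

section Resolution

variable (X : Type u) [MetricSpace X] (A : Type u) [AddCommGroup A]

lemma toSheafify_constToCYSheaf :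
    toSheafify (coarseTopology X) ((Functor.const (Set X)ᵒᵖ).obj (AddCommGrpCat.of A)) ≫
      (constToCYSheaf X A).hom = constToCYPresheaf X A :=
  (((sheafificationAdjunction (coarseTopology X) AddCommGrpCat.{u}).homEquiv_unit _ _
    (constToCYSheaf X A)).symm.trans (Equiv.apply_symm_apply _ _) :)

lemma CYSheafComplex_d (q : ℕ) : (CYSheafComplex X A).d q (q + 1) = CYSheafD X A q :=
  CochainComplex.of_d (CYSheaf X A) (CYSheafD X A) q

lemma CYAugmentation_f_zero : (CYAugmentation X A).f 0 = constToCYSheaf X A :=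
  CochainComplex.fromSingle₀Equiv_symm_apply_f_zero _ _

lemma constToCYSheaf_mono : Mono (constToCYSheaf X A) := by
  have h1 : Presheaf.IsLocallyInjective (coarseTopology X) (constToCYPresheaf X A) := by
    refine ⟨fun {U} a b hab ↦ ?_⟩
    refine (mem_coarseTopology_iff _).2 ?_
    by_cases h : (show A from a) = b
    · obtain rfl := h
      refine ⟨1, fun _ ↦ U.unop, isCoarseCover_iff.2 ⟨fun _ ↦ le_rfl, fun R ↦ ?_⟩, fun i ↦ rfl⟩
      refine Bornology.isBounded_empty.subset ?_
      rintro x ⟨-, hx⟩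
      obtain ⟨y, hy, hy', -⟩ := hx 0
      exact hy' hy
    · refine ⟨0, Fin.elim0, isCoarseCover_empty_of_constToCY_eq_zero (sub_ne_zero.2 h) ?_,
        fun i ↦ i.elim0⟩
      rw [map_sub, sub_eq_zero]
      exact hab
  rw [← toSheafify_constToCYSheaf] at h1
  have h2 : Sheaf.IsLocallyInjective (constToCYSheaf X A) :=
    @Presheaf.isLocallyInjective_of_isLocallyInjective_of_isLocallySurjective _ _
      (coarseTopology X) _ _ _ _ _ _ _ _ _ (toSheafify _ _) _ h1 inferInstance
  exact Sheaf.mono_of_isLocallyInjective _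

/-- The augmented complex `0 → F → K⁰ → K¹ → ⋯` is a resolution if it is exact. -/
lemma quasiIso_of_exact {C : Type*} [Category* C] [Abelian C] {F : C} {K : CochainComplex C ℕ}
    (ε : (CochainComplex.single₀ C).obj F ⟶ K) (hm : Mono (ε.f 0))
    (h0 : (ShortComplex.mk _ _ (resolution_comp_d ε)).Exact)
    (h : ∀ n, (ShortComplex.mk _ _ (K.d_comp_d n (n + 1) (n + 2))).Exact) : QuasiIso ε := by
  refine ⟨fun n ↦ ?_⟩
  cases n with
  | zero =>
    rw [CochainComplex.quasiIsoAt₀_iff]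
    exact (ShortComplex.quasiIso_iff_of_zeros _ (HomologicalComplex.single_obj_d (.up ℕ) _ _ _ _)
      (HomologicalComplex.single_obj_d (.up ℕ) _ _ _ _) (K.shape _ _ (by simp))).2 ⟨h0, hm⟩
  | succ n =>
    rw [quasiIsoAt_iff_exactAt ε (n + 1) (CochainComplex.exactAt_succ_single_obj _ _)]
    exact (HomologicalComplex.exactAt_iff' _ n (n + 1) (n + 2) (by simp)
      (by simp only [CochainComplex.next]; rfl)).2 (h n)

lemma CYAugmentation_quasiIso : QuasiIso (CYAugmentation X A) := by
  refine quasiIso_of_exact _ ?_ ?_ fun n ↦ ?_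
  · rw [CYAugmentation_f_zero]
    exact constToCYSheaf_mono X A
  · refine (exact_iff_locally_exact _).2 fun U s hs ↦ ?_
    replace hs : onSec ((CYSheafComplex X A).d 0 1) U s = 0 := hs
    rw [CYSheafComplex_d X A 0] at hs
    obtain ⟨n, V, hV, h⟩ := CY_locally_const (s : CY U A 0) hs
    refine ⟨n, V, hV, fun i ↦ ?_⟩
    obtain ⟨a, ha⟩ := h i
    refine ⟨((toSheafify (coarseTopology X) ((Functor.const (Set X)ᵒᵖ).obj
      (AddCommGrpCat.of A))).app (op (V i))).hom a, Eq.trans ?_ ha⟩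
    change onSec ((CYAugmentation X A).f 0) _ _ = _
    rw [CYAugmentation_f_zero]
    exact ConcreteCategory.congr_hom
      (NatTrans.congr_app (toSheafify_constToCYSheaf X A) (op (V i))) a
  · refine (exact_iff_locally_exact _).2 fun U s hs ↦ ?_
    replace hs : onSec ((CYSheafComplex X A).d (n + 1) (n + 2)) U s = 0 := hs
    rw [CYSheafComplex_d X A (n + 1)] at hs
    obtain ⟨m, V, hV, h⟩ := CY_locally_exact (s : CY U A (n + 1)) hs
    refine ⟨m, V, hV, fun i ↦ ?_⟩
    obtain ⟨t, ht⟩ := h i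
    refine ⟨t, Eq.trans ?_ ht⟩
    change onSec ((CYSheafComplex X A).d n (n + 1)) _ _ = _
    rw [CYSheafComplex_d X A n]
    rfl

end Resolution

section Flabby

variable {X : Type u} [MetricSpace X]

/-- A sheaf is called flabby here if every compatible family of sections on finitely many subsets
`V i` of `U` (which need not cover `U`) extends to `U`. -/
def IsFlabby (F : AbSheaf X) : Prop :=
  ∀ ⦃U : Set X⦄ ⦃n : ℕ⦄ ⦃V : Fin n → Set X⦄ (hV : ∀ i, V i ⊆ U) (c : ∀ i, Sec F (V i)),
    IsCompatible F c → ∃ s : Sec F U, ∀ i, res F (hV i) s = c i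

/-- The condition that the kernel of `f` is flabby. -/
def HasFlabbyKernel {G H : AbSheaf X} (f : G ⟶ H) : Prop :=
  ∀ ⦃U : Set X⦄ ⦃n : ℕ⦄ ⦃V : Fin n → Set X⦄ (hV : ∀ i, V i ⊆ U) (c : ∀ i, Sec G (V i)),
    IsCompatible G c → (∀ i, onSec f (V i) (c i) = 0) →
      ∃ s : Sec G U, onSec f U s = 0 ∧ ∀ i, res G (hV i) s = c i

lemma hasFlabbyKernel_of_injective {G H : AbSheaf X} (f : G ⟶ H)
    (h : ∀ U (s : Sec G U), onSec f U s = 0 → s = 0) : HasFlabbyKernel f :=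
  fun U n V hV c _ hc' ↦ ⟨0, map_zero _, fun i ↦ by rw [h _ _ (hc' i), map_zero]⟩

/-- If the kernel of `f` is flabby, liftable compatible families have compatible lifts. -/
lemma HasFlabbyKernel.exists_compatible_lift {G H : AbSheaf X} {f : G ⟶ H}
    (hf : HasFlabbyKernel f) {n : ℕ} {V : Fin n → Set X} {h : ∀ i, Sec H (V i)}
    (hh : IsCompatible H h) (hl : ∀ i, ∃ g, onSec f (V i) g = h i) :
    ∃ g : ∀ i, Sec G (V i), IsCompatible G g ∧ ∀ i, onSec f (V i) (g i) = h i := by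
  suffices H : ∀ k ≤ n, ∃ g : ∀ i, Sec G (V i), (∀ i, onSec f (V i) (g i) = h i) ∧
      ∀ i j : Fin n, (i : ℕ) < k → (j : ℕ) < k →
        res G (Set.inter_subset_left : V i ∩ V j ⊆ V i) (g i) =
          res G (Set.inter_subset_right : V i ∩ V j ⊆ V j) (g j) by
    obtain ⟨g, hg, hg'⟩ := H n le_rfl
    exact ⟨g, fun i j ↦ hg' i j i.2 j.2, hg⟩
  intro k
  induction k with
  | zero =>
    intro _
    choose g hg using hl
    exact ⟨g, hg, fun i j hi ↦ absurd hi (Nat.not_lt_zero _)⟩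
  | succ k ih =>
    intro hk
    obtain ⟨g, hg, hg'⟩ := ih (Nat.le_of_succ_le hk)
    let m : Fin n := ⟨k, hk⟩
    let ι : Fin k → Fin n := Fin.castLE (Nat.le_of_succ_le hk)
    have hcomp (i j : Fin k) {W : Set X} (hi : W ⊆ V (ι i)) (hj : W ⊆ V (ι j)) :
        res G hi (g (ι i)) = res G hj (g (ι j)) := by
      have := congrArg (res G (Set.subset_inter hi hj)) (hg' (ι i) (ι j) i.2 j.2)
      simpa using this
    obtain ⟨s, hs, hs'⟩ := hf (U := V m) (V := fun i : Fin k ↦ V (ι i) ∩ V m)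
      (fun i ↦ Set.inter_subset_right)
      (fun i ↦ res G Set.inter_subset_right (g m) - res G Set.inter_subset_left (g (ι i)))
      (fun i j ↦ by
        simp only [map_sub, res_res]
        rw [hcomp i j (Set.inter_subset_left.trans Set.inter_subset_left)
          (Set.inter_subset_right.trans Set.inter_subset_left)])
      (fun i ↦ by
        rw [map_sub, onSec_res, onSec_res, hg, hg, sub_eq_zero, hh])
    have key (i : Fin n) (hi : (i : ℕ) < k) {W : Set X} (h1 : W ⊆ V i) (h2 : W ⊆ V m) :
        res G h2 (g m - s) = res G h1 (g i) := by
      have := congrArg (res G (Set.subset_inter h1 h2)) (hs' ⟨i, hi⟩)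
      simp only [map_sub, res_res] at this
      rw [map_sub, this]
      exact sub_sub_cancel _ _
    refine ⟨Function.update g m (g m - s), fun i ↦ ?_, fun i j hi hj ↦ ?_⟩
    · by_cases him : i = m
      · subst him
        rw [Function.update_self, map_sub, hs, sub_zero, hg]
      · rw [Function.update_of_ne him, hg]
    · have hlt (i : Fin n) (hi : (i : ℕ) < k + 1) (him : i ≠ m) : (i : ℕ) < k :=
        lt_of_le_of_ne (Nat.le_of_lt_succ hi) fun h ↦ him (Fin.ext h)
      by_cases him : i = m
      · by_cases hjm : j = m
        · subst him hjm
          rfl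
        · subst him
          rw [Function.update_self, Function.update_of_ne hjm]
          exact key j (hlt j hj hjm) _ _
      · by_cases hjm : j = m
        · subst hjm
          rw [Function.update_self, Function.update_of_ne him]
          exact (key i (hlt i hi him) _ _).symm
        · rw [Function.update_of_ne him, Function.update_of_ne hjm]
          exact hg' i j (hlt i hi him) (hlt j hj hjm)

lemma HasFlabbyKernel.exists_lift {G H : AbSheaf X} {f : G ⟶ H}
    (hf : HasFlabbyKernel f) {U : Set X} (s : Sec H U)
    (hs : ∃ (n : ℕ) (V : Fin n → Set X) (hV : IsCoarseCover U V),
      ∀ i, ∃ t, onSec f (V i) t = res H (hV.subset i) s) :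
    ∃ t, onSec f U t = s := by
  obtain ⟨n, V, hV, h⟩ := hs
  obtain ⟨g, hg, hg'⟩ := hf.exists_compatible_lift
    (h := fun i ↦ res H (hV.subset i) s) (fun i j ↦ by simp) h
  obtain ⟨t, ht⟩ := sec_glue G hV g hg
  refine ⟨t, sec_ext H hV fun i ↦ ?_⟩
  rw [← onSec_res, ht, hg']

lemma HasFlabbyKernel.of_exact {F G H : AbSheaf X} {f : F ⟶ G} {g : G ⟶ H}
    (hf : HasFlabbyKernel f) (hF : IsFlabby F) (w : f ≫ g = 0)
    (h : ∀ (U : Set X) (s : Sec G U), onSec g U s = 0 → ∃ (n : ℕ) (V : Fin n → Set X)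
      (hV : IsCoarseCover U V), ∀ i, ∃ t, onSec f (V i) t = res G (hV.subset i) s) :
    HasFlabbyKernel g := by
  intro U n V hV c hc hc'
  obtain ⟨b, hb, hb'⟩ := hf.exists_compatible_lift hc
    fun i ↦ hf.exists_lift _ (h _ _ (hc' i))
  obtain ⟨t, ht⟩ := hF hV b hb
  refine ⟨onSec f U t, ?_, fun i ↦ ?_⟩
  · rw [← onSec_comp, w, onSec_zero]
  · rw [← onSec_res, ht, hb']

open Limits in
lemma biprod_sec_ext {F G : AbSheaf X} {U : Set X} {s t : Sec (F ⊞ G) U}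
    (h1 : onSec (biprod.fst : F ⊞ G ⟶ F) U s = onSec biprod.fst U t)
    (h2 : onSec (biprod.snd : F ⊞ G ⟶ G) U s = onSec biprod.snd U t) : s = t := by
  have key (s : Sec (F ⊞ G) U) : onSec (biprod.inl : F ⟶ F ⊞ G) U (onSec biprod.fst U s) +
      onSec (biprod.inr : G ⟶ F ⊞ G) U (onSec biprod.snd U s) = s := by
    have : onSec (biprod.fst ≫ biprod.inl + biprod.snd ≫ biprod.inr : F ⊞ G ⟶ F ⊞ G) U s = s := by
      rw [biprod.total]
      rfl
    exact this
  rw [← key s, ← key t, h1, h2]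

open Limits in
lemma exists_biprod_sec {F G : AbSheaf X} {U : Set X} (a : Sec F U) (b : Sec G U) :
    ∃ s : Sec (F ⊞ G) U, onSec (biprod.fst : F ⊞ G ⟶ F) U s = a ∧
      onSec (biprod.snd : F ⊞ G ⟶ G) U s = b := by
  refine ⟨onSec (biprod.inl : F ⟶ F ⊞ G) U a + onSec (biprod.inr : G ⟶ F ⊞ G) U b, ?_, ?_⟩
  · rw [map_add, ← onSec_comp, ← onSec_comp, biprod.inl_fst, biprod.inr_fst, onSec_zero, add_zero]
    rfl
  · rw [map_add, ← onSec_comp, ← onSec_comp, biprod.inl_snd, biprod.inr_snd, onSec_zero, zero_add]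
    rfl

open Limits in
lemma IsFlabby.biprod {F G : AbSheaf X} (hF : IsFlabby F) (hG : IsFlabby G) :
    IsFlabby (F ⊞ G) := by
  intro U n V hV c hc
  obtain ⟨a, ha⟩ := hF hV _ (hc.onSec (biprod.fst : F ⊞ G ⟶ F))
  obtain ⟨b, hb⟩ := hG hV _ (hc.onSec (biprod.snd : F ⊞ G ⟶ G))
  obtain ⟨s, hs1, hs2⟩ := exists_biprod_sec a b
  refine ⟨s, fun i ↦ biprod_sec_ext ?_ ?_⟩
  · rw [onSec_res, hs1, ha]
  · rw [onSec_res, hs2, hb]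

/-- Injective sheaves are flabby. -/
lemma isFlabby_of_injective (I : AbSheaf X) [Injective I] : IsFlabby I := by
  intro U n V hV c hc
  let adj := (AddCommGrpCat.adj.{u}.whiskerRight (Set X)ᵒᵖ).comp
    (sheafificationAdjunction (coarseTopology X) AddCommGrpCat.{u})
  have : (((Functor.whiskeringRight (Set X)ᵒᵖ (Type u) AddCommGrpCat.{u}).obj
      AddCommGrpCat.free.{u}) ⋙ presheafToSheaf (coarseTopology X)
        AddCommGrpCat.{u}).PreservesMonomorphisms := by
    have : ((Functor.whiskeringRight (Set X)ᵒᵖ (Type u) AddCommGrpCat.{u}).obj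
        AddCommGrpCat.free.{u}).PreservesMonomorphisms := ⟨fun {P Q} f hf ↦ by
      have (U : (Set X)ᵒᵖ) : Mono ((Functor.whiskerRight f AddCommGrpCat.free.{u}).app U) :=
        AddCommGrpCat.free.{u}.map_mono (f.app U)
      exact NatTrans.mono_of_mono_app (Functor.whiskerRight f AddCommGrpCat.free.{u})⟩
    infer_instance
  have hI : Injective (I.obj ⋙ forget AddCommGrpCat.{u}) := Injective.injective_of_adjoint adj I
  let S : Sieve U := Sieve.generate (Presieve.ofArrows V fun i ↦ homOfLE (hV i))
  have hS (W : (Set X)ᵒᵖ) (f : S.functor.obj W) : ∃ i, W.unop ⊆ V i := by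
    obtain ⟨f, _, g, _, ⟨i⟩, -⟩ := f
    exact ⟨i, leOfHom g⟩
  choose k hk using hS
  let τ : S.functor ⟶ I.obj ⋙ forget AddCommGrpCat.{u} :=
    { app := fun W ↦ TypeCat.ofHom fun f ↦ res I (hk W f) (c (k W f))
      naturality := fun W W' g ↦ by
        ext f
        refine (hc.res_eq _ _).trans (res_res I (hk W f) (leOfHom g.unop) _).symm }
  let e := Injective.factorThru τ S.functorInclusion
  have he : S.functorInclusion ≫ e = τ := Injective.comp_factorThru _ _
  refine ⟨yonedaEquiv e, fun i ↦ ?_⟩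
  have hi : S (homOfLE (hV i)) := Sieve.le_generate _ _ _ ⟨i⟩
  have h1 := ConcreteCategory.congr_hom (NatTrans.congr_app he (op (V i))) ⟨homOfLE (hV i), hi⟩
  have h2 : τ.app (op (V i)) ⟨homOfLE (hV i), hi⟩ = c i :=
    (hc.res_eq _ le_rfl).trans (res_self I _ _)
  exact (map_yonedaEquiv e (homOfLE (hV i))).trans (h1.trans h2)

open Classical in
/-- The sheaves `CY_b^q( · , A)` are flabby. -/
lemma isFlabby_CYSheaf (A : Type u) [AddCommGroup A] (q : ℕ) : IsFlabby (CYSheaf X A q) := by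
  intro U n V hV c hc
  have hmk (i : Fin n) : ∃ φ : blocky A (V i) q, (QuotientAddGroup.mk φ : CY (V i) A q) = c i :=
    QuotientAddGroup.mk_surjective (c i)
  choose φ hφ using hmk
  choose ψ hψ hψ' using fun i ↦ exists_blocky_extension (hV i) (φ i)
  have hQ (i : Fin n) : IsBlocky fun x : Fin (q + 1) → U ↦ ∀ j, (x j : X) ∈ V i := by
    refine isBlocky_of_finite (κ := Prop) (fun u : U ↦ (u : X) ∈ V i) fun x y hxy ↦ ?_
    exact propext (forall_congr' fun j ↦ iff_of_eq (hxy j))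
  let F (v : Fin n → Prop × A) : A := if h : ∃ i, (v i).1 then (v h.choose).2 else 0
  have hF (v : Fin n → Prop × A) (h : ∃ i, (v i).1) : ∃ i, (v i).1 ∧ F v = (v i).2 :=
    ⟨h.choose, h.choose_spec, dif_pos h⟩
  let Φ : (Fin (q + 1) → U) → A := fun x ↦ F fun i ↦ (∀ j, (x j : X) ∈ V i, ψ i x)
  have hΦ : IsBlocky Φ := by
    have h := isBlocky_pi fun i ↦ (hQ i).map₂ (hψ i) fun a b ↦ (a, b)
    exact h.map₂ h fun v _ ↦ F v
  refine ⟨(QuotientAddGroup.mk ⟨Φ, hΦ⟩ : CY U A q), fun k ↦ Eq.trans ?_ (hφ k)⟩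
  refine (CY_mk_eq_iff (blockyMap A (Set.inclusion (hV k)) q ⟨Φ, hΦ⟩) (φ k)).2 ?_
  have hik (i : Fin n) : IsCocontrolled {x : Fin (q + 1) → ↥(V i ∩ V k) |
      (φ i).1 (Set.inclusion Set.inter_subset_left ∘ x) ≠
        (φ k).1 (Set.inclusion Set.inter_subset_right ∘ x)} := by
    have := hc i k
    rw [← hφ i, ← hφ k] at this
    exact (CY_mk_eq_iff (blockyMap A (Set.inclusion Set.inter_subset_left) q (φ i))
      (blockyMap A (Set.inclusion Set.inter_subset_right) q (φ k))).1 this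
  refine (isCocontrolled_iUnion fun i ↦ isCocontrolled_image_inclusion
    (Set.inter_subset_right : V i ∩ V k ⊆ V k) (hik i)).mono ?_
  intro x hx
  obtain ⟨i, hi, hi'⟩ := hF (fun i ↦ (∀ j, ((Set.inclusion (hV k) ∘ x) j : X) ∈ V i,
    ψ i (Set.inclusion (hV k) ∘ x))) ⟨k, fun j ↦ (x j).2⟩
  refine Set.mem_iUnion.2 ⟨i, fun j ↦ ⟨x j, hi j, (x j).2⟩, ?_, rfl⟩
  intro heq
  refine hx (hi'.trans (Eq.trans ?_ heq))
  exact hψ' i fun j ↦ ⟨x j, hi j⟩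

end Flabby

section ElementwiseQuasiIso

lemma quasiIso_of_elements_shortComplex {S T : ShortComplex AddCommGrpCat.{u}} (φ : S ⟶ T)
    (inj : ∀ (x : S.X₂) (y : T.X₁), S.g x = 0 → φ.τ₂ x = T.f y → ∃ z, S.f z = x)
    (surj : ∀ y : T.X₂, T.g y = 0 → ∃ (x : S.X₂) (y' : T.X₁), S.g x = 0 ∧ φ.τ₂ x + T.f y' = y) :
    ShortComplex.QuasiIso φ := by
  have cyc (S : ShortComplex AddCommGrpCat.{u}) (x : S.X₂) (hx : S.g x = 0) :
      ∃ c : S.cycles, S.iCycles c = x :=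
    (ShortComplex.ab_exact_iff (ShortComplex.mk S.iCycles S.g S.iCycles_g)).1
      (ShortComplex.exact_of_f_is_kernel _ S.cyclesIsKernel) x hx
  have bd (S : ShortComplex AddCommGrpCat.{u}) (c : S.cycles) (hc : S.homologyπ c = 0) :
      ∃ z : S.X₁, S.toCycles z = c :=
    (ShortComplex.ab_exact_iff (ShortComplex.mk S.toCycles S.homologyπ S.toCycles_comp_homologyπ)).1
      (ShortComplex.exact_of_g_is_cokernel _ S.homologyIsCokernel) c hc
  have iinj (S : ShortComplex AddCommGrpCat.{u}) : Function.Injective S.iCycles :=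
    (AddCommGrpCat.mono_iff_injective _).1 inferInstance
  have πsurj (S : ShortComplex AddCommGrpCat.{u}) : Function.Surjective S.homologyπ :=
    (AddCommGrpCat.epi_iff_surjective _).1 inferInstance
  have iw (c : S.cycles) : T.iCycles (ShortComplex.cyclesMap φ c) = φ.τ₂ (S.iCycles c) :=
    ConcreteCategory.congr_hom (ShortComplex.cyclesMap_i φ) c
  have πw (c : S.cycles) : ShortComplex.homologyMap φ (S.homologyπ c) =
      T.homologyπ (ShortComplex.cyclesMap φ c) :=
    ConcreteCategory.congr_hom (ShortComplex.homologyπ_naturality φ) c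
  have ti (S : ShortComplex AddCommGrpCat.{u}) (z : S.X₁) : S.iCycles (S.toCycles z) = S.f z :=
    ConcreteCategory.congr_hom S.toCycles_i z
  have ig (S : ShortComplex AddCommGrpCat.{u}) (c : S.cycles) : S.g (S.iCycles c) = 0 :=
    ConcreteCategory.congr_hom S.iCycles_g c
  have tπ (S : ShortComplex AddCommGrpCat.{u}) (z : S.X₁) : S.homologyπ (S.toCycles z) = 0 :=
    ConcreteCategory.congr_hom S.toCycles_comp_homologyπ z
  refine ⟨(ConcreteCategory.isIso_iff_bijective _).2 ⟨?_, ?_⟩⟩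
  · refine (injective_iff_map_eq_zero (ShortComplex.homologyMap φ).hom).2 fun a ha ↦ ?_
    obtain ⟨c, rfl⟩ := πsurj S a
    obtain ⟨y, hy⟩ := bd T _ ((πw c).symm.trans ha)
    obtain ⟨z, hz⟩ := inj (S.iCycles c) y (ig S c) (by rw [← iw, ← hy, ti])
    rw [← ti] at hz
    rw [← iinj S hz, tπ]
  · intro b
    obtain ⟨d, rfl⟩ := πsurj T b
    obtain ⟨x, y', hx, hy⟩ := surj (T.iCycles d) (ig T d)
    obtain ⟨c, rfl⟩ := cyc S x hx
    refine ⟨S.homologyπ c, ?_⟩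
    have : ShortComplex.cyclesMap φ c + T.toCycles y' = d := iinj T (by
      rw [map_add, iw, ti, hy])
    rw [πw, ← this, map_add, tπ, add_zero]

lemma quasiIso_of_elements {K L : CochainComplex AddCommGrpCat.{u} ℕ} (φ : K ⟶ L)
    (inj₀ : ∀ x : K.X 0, K.d 0 1 x = 0 → φ.f 0 x = 0 → x = 0)
    (surj₀ : ∀ y : L.X 0, L.d 0 1 y = 0 → ∃ x : K.X 0, K.d 0 1 x = 0 ∧ φ.f 0 x = y)
    (inj : ∀ n (x : K.X (n + 1)) (y : L.X n), K.d (n + 1) (n + 2) x = 0 →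
      φ.f (n + 1) x = L.d n (n + 1) y → ∃ z, K.d n (n + 1) z = x)
    (surj : ∀ n (y : L.X (n + 1)), L.d (n + 1) (n + 2) y = 0 → ∃ (x : K.X (n + 1)) (y' : L.X n),
      K.d (n + 1) (n + 2) x = 0 ∧ φ.f (n + 1) x + L.d n (n + 1) y' = y) : QuasiIso φ := by
  refine ⟨fun n ↦ ?_⟩
  cases n with
  | zero =>
    rw [quasiIsoAt_iff' φ 0 0 1 (by simp) (by simp)]
    have hK (x : K.X 0) : K.d 0 0 x = 0 := by rw [K.shape 0 0 (by simp)]; rfl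
    have hL (x : L.X 0) : L.d 0 0 x = 0 := by rw [L.shape 0 0 (by simp)]; rfl
    refine quasiIso_of_elements_shortComplex _ (fun x y hx hy ↦ ?_) fun y hy ↦ ?_
    · exact ⟨0, (map_zero _).trans (inj₀ x hx (hy.trans (hL y))).symm⟩
    · obtain ⟨x, hx, hxy⟩ := surj₀ y hy
      exact ⟨x, 0, hx, (congrArg (_ + ·) (map_zero _)).trans ((add_zero _).trans hxy)⟩
  | succ n =>
    rw [quasiIsoAt_iff' φ n (n + 1) (n + 2) (by simp) (by simp only [CochainComplex.next]; rfl)]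
    exact quasiIso_of_elements_shortComplex _ (inj n) (surj n)

end ElementwiseQuasiIso

section FlabbyResolution

variable {X : Type u} [MetricSpace X]

lemma locally_lift_trans {F G : AbSheaf X} (f : F ⟶ G) {U : Set X} (s : Sec G U)
    (h : ∃ (n : ℕ) (V : Fin n → Set X) (hV : IsCoarseCover U V), ∀ i,
      ∃ (m : ℕ) (W : Fin m → Set X) (hW : IsCoarseCover (V i) W), ∀ j,
        ∃ t, onSec f (W j) t = res G (hW.subset j) (res G (hV.subset i) s)) :
    ∃ (n : ℕ) (V : Fin n → Set X) (hV : IsCoarseCover U V), ∀ i,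
      ∃ t, onSec f (V i) t = res G (hV.subset i) s := by
  obtain ⟨n, V, hV, h⟩ := h
  refine (mem_coarseTopology_iff (Presheaf.imageSieve f.hom s)).1 ?_
  refine (coarseTopology X).transitive
    (S := Sieve.generate (Presieve.ofArrows V fun i ↦ homOfLE (hV.subset i)))
    ((mem_coarseTopology_iff _).2 ⟨n, V, hV, fun i ↦ Sieve.le_generate _ _ _ ⟨i⟩⟩) _ ?_
  rintro Y _ ⟨_, g, _, ⟨i⟩, rfl⟩
  rw [Sieve.pullback_comp]
  refine (coarseTopology X).pullback_stable _ ((mem_coarseTopology_iff _).2 ?_)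
  obtain ⟨m, W, hW, h⟩ := h i
  refine ⟨m, W, hW, fun j ↦ ?_⟩
  obtain ⟨t, ht⟩ := h j
  exact ⟨t, ht.trans (res_res _ _ _ _)⟩

lemma locally_exact_succ {F : AbSheaf X} {K : CochainComplex (AbSheaf X) ℕ}
    (ε : (CochainComplex.single₀ (AbSheaf X)).obj F ⟶ K) [QuasiIso ε] (n : ℕ) {U : Set X}
    (s : Sec (K.X (n + 1)) U) (hs : onSec (K.d (n + 1) (n + 2)) U s = 0) :
    ∃ (m : ℕ) (V : Fin m → Set X) (hV : IsCoarseCover U V), ∀ i,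
      ∃ t, onSec (K.d n (n + 1)) (V i) t = res _ (hV.subset i) s :=
  (exact_iff_locally_exact _).1 (resolution_exact_succ ε n) U s hs

lemma locally_exact_zero {F : AbSheaf X} {K : CochainComplex (AbSheaf X) ℕ}
    (ε : (CochainComplex.single₀ (AbSheaf X)).obj F ⟶ K) [QuasiIso ε] {U : Set X}
    (s : Sec (K.X 0) U) (hs : onSec (K.d 0 1) U s = 0) :
    ∃ (m : ℕ) (V : Fin m → Set X) (hV : IsCoarseCover U V), ∀ i,
      ∃ t, onSec (ε.f 0) (V i) t = res _ (hV.subset i) s :=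
  (exact_iff_locally_exact _).1 (resolution_exact_zero ε).1 U s hs

lemma exists_of_locally_exact_zero {F : AbSheaf X} {K : CochainComplex (AbSheaf X) ℕ}
    (ε : (CochainComplex.single₀ (AbSheaf X)).obj F ⟶ K) [QuasiIso ε] {U : Set X}
    (s : Sec (K.X 0) U) (hs : onSec (K.d 0 1) U s = 0) : ∃ t, onSec (ε.f 0) U t = s := by
  have := (resolution_exact_zero ε).2
  exact (hasFlabbyKernel_of_injective _ fun U s hs ↦
    onSec_injective (ε.f 0) U (hs.trans (map_zero _).symm)).exists_lift s (locally_exact_zero ε s hs)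

variable {K L : CochainComplex (AbSheaf X) ℕ} (φ : K ⟶ L)

lemma onSec_d_comm (i j : ℕ) {U : Set X} (x : Sec (K.X i) U) :
    onSec (L.d i j) U (onSec (φ.f i) U x) = onSec (φ.f j) U (onSec (K.d i j) U x) := by
  rw [← onSec_comp, φ.comm, onSec_comp]

open Limits in
/-- The differential `K⁰ → K¹ ⊕ L⁰` of the mapping cone. -/
def coneD₀ : K.X 0 ⟶ K.X 1 ⊞ L.X 0 := biprod.lift (K.d 0 1) (φ.f 0)

open Limits in
/-- The differential `Kⁿ⁺¹ ⊕ Lⁿ → Kⁿ⁺² ⊕ Lⁿ⁺¹` of the mapping cone. -/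
def coneD (n : ℕ) : K.X (n + 1) ⊞ L.X n ⟶ K.X (n + 2) ⊞ L.X (n + 1) :=
  biprod.lift (biprod.fst ≫ K.d _ _) (biprod.fst ≫ φ.f _ - biprod.snd ≫ L.d _ _)

open Limits in
lemma coneD₀_comp : coneD₀ φ ≫ coneD φ 0 = 0 := by
  refine biprod.hom_ext _ _ ?_ ?_
  · simp [coneD₀, coneD]
  · simp [coneD₀, coneD]

open Limits in
lemma coneD_comp (n : ℕ) : coneD φ n ≫ coneD φ (n + 1) = 0 := by
  refine biprod.hom_ext _ _ ?_ ?_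
  · simp [coneD]
  · simp [coneD, Preadditive.sub_comp]

open Limits in
lemma onSec_coneD₀_eq_iff {U : Set X} (x : Sec (K.X 0) U) (s : Sec (K.X 1 ⊞ L.X 0) U) :
    onSec (coneD₀ φ) U x = s ↔ onSec (K.d 0 1) U x = onSec biprod.fst U s ∧
      onSec (φ.f 0) U x = onSec biprod.snd U s := by
  have h1 : onSec biprod.fst U (onSec (coneD₀ φ) U x) = onSec (K.d 0 1) U x := by
    rw [← onSec_comp, coneD₀, biprod.lift_fst]
  have h2 : onSec biprod.snd U (onSec (coneD₀ φ) U x) = onSec (φ.f 0) U x := by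
    rw [← onSec_comp, coneD₀, biprod.lift_snd]
  rw [← h1, ← h2]
  exact ⟨fun h ↦ by simp only [h, and_self], fun h ↦ biprod_sec_ext h.1 h.2⟩

open Limits in
lemma onSec_coneD_eq_iff (n : ℕ) {U : Set X} (r : Sec (K.X (n + 1) ⊞ L.X n) U)
    (s : Sec (K.X (n + 2) ⊞ L.X (n + 1)) U) :
    onSec (coneD φ n) U r = s ↔
      onSec (K.d (n + 1) (n + 2)) U (onSec biprod.fst U r) = onSec biprod.fst U s ∧
      onSec (φ.f (n + 1)) U (onSec biprod.fst U r) - onSec (L.d n (n + 1)) U (onSec biprod.snd U r)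
        = onSec biprod.snd U s := by
  have h1 : onSec biprod.fst U (onSec (coneD φ n) U r) =
      onSec (K.d (n + 1) (n + 2)) U (onSec biprod.fst U r) := by
    rw [← onSec_comp, coneD, biprod.lift_fst, onSec_comp]
  have h2 : onSec biprod.snd U (onSec (coneD φ n) U r) =
      onSec (φ.f (n + 1)) U (onSec biprod.fst U r) -
        onSec (L.d n (n + 1)) U (onSec biprod.snd U r) := by
    rw [← onSec_comp, coneD, biprod.lift_snd]
    rfl
  rw [← h1, ← h2]
  exact ⟨fun h ↦ by simp only [h, and_self], fun h ↦ biprod_sec_ext h.1 h.2⟩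

variable {φ} {F : AbSheaf X} {ε : (CochainComplex.single₀ (AbSheaf X)).obj F ⟶ K}
  {η : (CochainComplex.single₀ (AbSheaf X)).obj F ⟶ L} [QuasiIso ε] [QuasiIso η]

lemma coneD₀_injective (w : ε ≫ φ = η) {U : Set X} (x : Sec (K.X 0) U)
    (hx : onSec (coneD₀ φ) U x = 0) : x = 0 := by
  obtain ⟨h1, h2⟩ := (onSec_coneD₀_eq_iff φ x 0).1 hx
  rw [map_zero] at h1 h2
  obtain ⟨t, rfl⟩ := exists_of_locally_exact_zero ε x h1
  have := (resolution_exact_zero η).2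
  rw [← onSec_comp, ← HomologicalComplex.comp_f, w] at h2
  rw [onSec_injective (η.f 0) U (h2.trans (map_zero _).symm), map_zero]

open Limits in
lemma coneD₀_locally_exact (w : ε ≫ φ = η) {U : Set X} (s : Sec (K.X 1 ⊞ L.X 0) U)
    (hs : onSec (coneD φ 0) U s = 0) :
    ∃ (n : ℕ) (V : Fin n → Set X) (hV : IsCoarseCover U V), ∀ i,
      ∃ t, onSec (coneD₀ φ) (V i) t = res _ (hV.subset i) s := by
  obtain ⟨h1, h2⟩ := (onSec_coneD_eq_iff φ 0 s 0).1 hs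
  rw [map_zero] at h1 h2
  refine locally_lift_trans _ s ?_
  obtain ⟨n, V, hV, h⟩ := locally_exact_succ ε 0 _ h1
  refine ⟨n, V, hV, fun i ↦ ?_⟩
  obtain ⟨x, hx⟩ := h i
  obtain ⟨m, W, hW, h⟩ := locally_exact_zero η
    (res _ (hV.subset i) (onSec biprod.snd U s) - onSec (φ.f 0) (V i) x) (by
      rw [map_sub, onSec_res, onSec_d_comm, hx, onSec_res, ← map_sub,
        ← neg_sub, h2, neg_zero, map_zero])
  refine ⟨m, W, hW, fun j ↦ ?_⟩
  obtain ⟨t, ht⟩ := h j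
  refine ⟨res _ (hW.subset j) x + onSec (ε.f 0) (W j) t, (onSec_coneD₀_eq_iff φ _ _).2 ⟨?_, ?_⟩⟩
  · rw [map_add, onSec_res, hx, ← onSec_comp, resolution_comp_d, onSec_zero, add_zero, onSec_res,
      onSec_res]
  · rw [map_add, ← onSec_comp, ← HomologicalComplex.comp_f, w, ht, onSec_res, ← map_add,
      add_sub_cancel, onSec_res, onSec_res]

open Limits in
lemma coneD_locally_exact (ε : (CochainComplex.single₀ (AbSheaf X)).obj F ⟶ K)
    (η : (CochainComplex.single₀ (AbSheaf X)).obj F ⟶ L) [QuasiIso ε] [QuasiIso η] (n : ℕ) {U : Set X}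
    (s : Sec (K.X (n + 2) ⊞ L.X (n + 1)) U) (hs : onSec (coneD φ (n + 1)) U s = 0) :
    ∃ (m : ℕ) (V : Fin m → Set X) (hV : IsCoarseCover U V), ∀ i,
      ∃ t, onSec (coneD φ n) (V i) t = res _ (hV.subset i) s := by
  obtain ⟨h1, h2⟩ := (onSec_coneD_eq_iff φ (n + 1) s 0).1 hs
  rw [map_zero] at h1 h2
  refine locally_lift_trans _ s ?_
  obtain ⟨m, V, hV, h⟩ := locally_exact_succ ε (n + 1) _ h1
  refine ⟨m, V, hV, fun i ↦ ?_⟩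
  obtain ⟨x, hx⟩ := h i
  obtain ⟨m, W, hW, h⟩ := locally_exact_succ η n
    (onSec (φ.f (n + 1)) (V i) x - res _ (hV.subset i) (onSec biprod.snd U s)) (by
      rw [map_sub, onSec_res, onSec_d_comm, hx, onSec_res, ← map_sub, h2, map_zero])
  refine ⟨m, W, hW, fun j ↦ ?_⟩
  obtain ⟨y, hy⟩ := h j
  obtain ⟨r, hr1, hr2⟩ := exists_biprod_sec (res _ (hW.subset j) x) y
  refine ⟨r, (onSec_coneD_eq_iff φ n _ _).2 ⟨?_, ?_⟩⟩
  · rw [hr1, onSec_res, hx, onSec_res, onSec_res]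
  · rw [hr1, hr2, hy, onSec_res, ← map_sub, sub_sub_cancel, onSec_res, onSec_res]

/-- A comparison of flabby resolutions is a quasi-isomorphism on global sections. -/
lemma quasiIso_globalSections_of_flabby (w : ε ≫ φ = η) (hK : ∀ n, IsFlabby (K.X n))
    (hL : ∀ n, IsFlabby (L.X n)) :
    QuasiIso (((globalSections X).mapHomologicalComplex (ComplexShape.up ℕ)).map φ) := by
  have h0 : HasFlabbyKernel (coneD₀ φ) := hasFlabbyKernel_of_injective _ fun U x hx ↦
    coneD₀_injective w x hx
  have h (n : ℕ) : HasFlabbyKernel (coneD φ n) := by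
    induction n with
    | zero => exact h0.of_exact (hK 0) (coneD₀_comp φ) fun U s hs ↦ coneD₀_locally_exact w s hs
    | succ n ih => exact ih.of_exact ((hK _).biprod (hL _)) (coneD_comp φ n) fun U s hs ↦
        coneD_locally_exact ε η n s hs
  have e0 (x : Sec (K.X 1) ⊤) (y : Sec (L.X 0) ⊤) (hx : onSec (K.d 1 2) ⊤ x = 0)
      (hxy : onSec (φ.f 1) ⊤ x = onSec (L.d 0 1) ⊤ y) :
      ∃ z, onSec (K.d 0 1) ⊤ z = x ∧ onSec (φ.f 0) ⊤ z = y := by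
    obtain ⟨s, hs1, hs2⟩ := exists_biprod_sec x y
    obtain ⟨z, hz⟩ := h0.exists_lift s (coneD₀_locally_exact w s
      ((onSec_coneD_eq_iff φ 0 _ _).2 ⟨by rw [hs1, hx, map_zero], by
        rw [hs1, hs2, hxy, sub_self, map_zero]⟩))
    refine ⟨z, ?_⟩
    have := (onSec_coneD₀_eq_iff φ _ _).1 hz
    rwa [hs1, hs2] at this
  have e (n : ℕ) (x : Sec (K.X (n + 2)) ⊤) (y : Sec (L.X (n + 1)) ⊤)
      (hx : onSec (K.d (n + 2) (n + 3)) ⊤ x = 0)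
      (hxy : onSec (φ.f (n + 2)) ⊤ x = onSec (L.d (n + 1) (n + 2)) ⊤ y) :
      ∃ z z', onSec (K.d (n + 1) (n + 2)) ⊤ z = x ∧
        onSec (φ.f (n + 1)) ⊤ z - onSec (L.d n (n + 1)) ⊤ z' = y := by
    obtain ⟨s, hs1, hs2⟩ := exists_biprod_sec x y
    obtain ⟨r, hr⟩ := (h n).exists_lift s (coneD_locally_exact ε η n s
      ((onSec_coneD_eq_iff φ (n + 1) _ _).2 ⟨by rw [hs1, hx, map_zero], by
        rw [hs1, hs2, hxy, sub_self, map_zero]⟩))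
    have := (onSec_coneD_eq_iff φ n _ _).1 hr
    rw [hs1, hs2] at this
    exact ⟨_, _, this⟩
  refine quasiIso_of_elements _ ?_ ?_ ?_ ?_
  · intro x hx hx'
    exact coneD₀_injective w (U := ⊤) x ((onSec_coneD₀_eq_iff φ _ _).2
      ⟨hx.trans (map_zero _).symm, hx'.trans (map_zero _).symm⟩)
  · intro y hy
    obtain ⟨z, hz⟩ := e0 0 y (map_zero _) ((map_zero _).trans hy.symm)
    exact ⟨z, hz⟩
  · intro n x y hx hxy
    cases n with
    | zero =>
      obtain ⟨z, hz, -⟩ := e0 x y hx hxy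
      exact ⟨z, hz⟩
    | succ n =>
      obtain ⟨z, -, hz, -⟩ := e n x y hx hxy
      exact ⟨z, hz⟩
  · intro n y hy
    obtain ⟨z, z', hz, hz'⟩ := e n 0 y (map_zero _) ((map_zero _).trans hy.symm)
    refine ⟨z, -z', hz, ?_⟩
    rw [sub_eq_add_neg, ← map_neg] at hz'
    exact hz'

lemma isIso_resolutionComparison_of_flabby (hK : ∀ n, IsFlabby (K.X n)) (q : ℕ) :
    IsIso (resolutionComparison (globalSections X) ε q) := by
  have h := quasiIso_globalSections_of_flabby
    (exists_lift_of_resolution ε (injectiveResolution F)).choose_spec hK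
    fun n ↦ isFlabby_of_injective _
  have h' := (quasiIsoAt_iff_isIso_homologyMap _ q).1 (h.quasiIsoAt q)
  exact @IsIso.comp_isIso _ _ _ _ _ _ _ h' (Iso.isIso_inv _)

end FlabbyResolution

section Comparison

variable {C : Type*} [Category* C] [Abelian C]

/-- Morphisms from a resolution to an injective resolution are unique up to homotopy. -/
lemma nonempty_homotopy_of_resolution {F G : C} {K : CochainComplex C ℕ}
    (ε : (CochainComplex.single₀ C).obj F ⟶ K) [QuasiIso ε] (I : InjectiveResolution G)
    (f g : K ⟶ I.cocomplex) (w : ε ≫ f = ε ≫ g) : Nonempty (Homotopy f g) := by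
  refine ⟨Homotopy.equivSubZero.symm ?_⟩
  have comm : ε.f 0 ≫ (f - g).f 0 = 0 := by
    have := HomologicalComplex.congr_hom w 0
    simp only [HomologicalComplex.comp_f] at this
    rw [HomologicalComplex.sub_f_apply, Preadditive.comp_sub, this, sub_self]
  obtain ⟨h0, -⟩ := resolution_exact_zero ε
  let z : K.X 1 ⟶ I.cocomplex.X 0 := h0.descToInjective ((f - g).f 0) comm
  have hz : K.d 0 1 ≫ z = (f - g).f 0 := h0.comp_descToInjective _ _
  let o : K.X 2 ⟶ I.cocomplex.X 1 := (resolution_exact_succ ε 0).descToInjective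
    ((f - g).f 1 - z ≫ I.cocomplex.d 0 1) (by
      dsimp only
      rw [Preadditive.comp_sub, reassoc_of% hz, ← HomologicalComplex.Hom.comm, sub_self])
  have ho : K.d 1 2 ≫ o = (f - g).f 1 - z ≫ I.cocomplex.d 0 1 :=
    (resolution_exact_succ ε 0).comp_descToInjective _ _
  refine Homotopy.mkCoinductive _ z hz.symm o (by rw [ho]; abel) fun n ⟨p, p', w⟩ ↦
    ⟨(resolution_exact_succ ε (n + 1)).descToInjective ((f - g).f (n + 2) - p' ≫ I.cocomplex.d _ _)
      (by
        dsimp only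
        rw [Preadditive.comp_sub, ← HomologicalComplex.Hom.comm, w, Preadditive.add_comp,
          Category.assoc, Category.assoc, HomologicalComplex.d_comp_d, Limits.comp_zero,
          zero_add, sub_self]), ?_⟩
  have := (resolution_exact_succ ε (n + 1)).comp_descToInjective
    ((f - g).f (n + 2) - p' ≫ I.cocomplex.d _ _) (by
        dsimp only
        rw [Preadditive.comp_sub, ← HomologicalComplex.Hom.comm, w, Preadditive.add_comp,
          Category.assoc, Category.assoc, HomologicalComplex.d_comp_d, Limits.comp_zero,
          zero_add, sub_self])
  dsimp only at this
  rw [this]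
  abel

variable {D : Type*} [Category* D] [Abelian D] [HasInjectiveResolutions C]

/-- The cohomology of the chosen injective resolution is the right derived functor. -/
def homologyIsoRightDerived (Γ : C ⥤ D) [Γ.Additive] (F : C) (q : ℕ) :
    ((Γ.mapHomologicalComplex (ComplexShape.up ℕ)).obj
      (injectiveResolution F).cocomplex).homology q ≅ (Γ.rightDerived q).obj F :=
  ((injectiveResolution F).isoRightDerivedObj Γ q).symm

lemma homologyIsoRightDerived_naturality (Γ : C ⥤ D) [Γ.Additive] {F F' : C} (f : F ⟶ F')
    (ψ : (injectiveResolution F).cocomplex ⟶ (injectiveResolution F').cocomplex)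
    (w : (injectiveResolution F).ι.f 0 ≫ ψ.f 0 = f ≫ (injectiveResolution F').ι.f 0) (q : ℕ) :
    (homologyIsoRightDerived Γ F q).hom ≫ (Γ.rightDerived q).map f =
      HomologicalComplex.homologyMap ((Γ.mapHomologicalComplex (ComplexShape.up ℕ)).map ψ) q ≫
        (homologyIsoRightDerived Γ F' q).hom :=
  InjectiveResolution.isoRightDerivedObj_inv_naturality f _ _ ψ w Γ q

/-- The comparison map may be computed by any morphism to the injective resolution. -/
lemma resolutionComparison_eq (Γ : C ⥤ D) [Γ.Additive] {F : C} {K : CochainComplex C ℕ}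
    (ε : (CochainComplex.single₀ C).obj F ⟶ K) [QuasiIso ε] (q : ℕ)
    (φ : K ⟶ (injectiveResolution F).cocomplex) (w : ε ≫ φ = (injectiveResolution F).ι) :
    resolutionComparison Γ ε q =
      HomologicalComplex.homologyMap ((Γ.mapHomologicalComplex (ComplexShape.up ℕ)).map φ) q ≫
        (homologyIsoRightDerived Γ F q).hom := by
  obtain ⟨h⟩ := nonempty_homotopy_of_resolution ε (injectiveResolution F)
    (exists_lift_of_resolution ε (injectiveResolution F)).choose φ
    ((exists_lift_of_resolution ε (injectiveResolution F)).choose_spec.trans w.symm)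
  exact congrArg (· ≫ (homologyIsoRightDerived Γ F q).hom) ((Γ.mapHomotopy h).homologyMap_eq q)

/-- The comparison map is natural in the resolution. -/
lemma resolutionComparison_naturality (Γ : C ⥤ D) [Γ.Additive] {F F' : C}
    {K K' : CochainComplex C ℕ}
    (ε : (CochainComplex.single₀ C).obj F ⟶ K) [QuasiIso ε]
    (ε' : (CochainComplex.single₀ C).obj F' ⟶ K') [QuasiIso ε']
    (f : F ⟶ F') (θ : K ⟶ K') (w : ε ≫ θ = (CochainComplex.single₀ C).map f ≫ ε') (q : ℕ) :
    resolutionComparison Γ ε q ≫ (Γ.rightDerived q).map f =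
      HomologicalComplex.homologyMap ((Γ.mapHomologicalComplex (ComplexShape.up ℕ)).map θ) q ≫
        resolutionComparison Γ ε' q := by
  obtain ⟨φ, hφ⟩ := exists_lift_of_resolution ε (injectiveResolution F)
  obtain ⟨φ', hφ'⟩ := exists_lift_of_resolution ε' (injectiveResolution F')
  let ψ := InjectiveResolution.desc f (injectiveResolution F') (injectiveResolution F)
  have hψ : (injectiveResolution F).ι ≫ ψ =
      (CochainComplex.single₀ C).map f ≫ (injectiveResolution F').ι :=
    InjectiveResolution.desc_commutes _ _ _
  obtain ⟨h⟩ := nonempty_homotopy_of_resolution ε (injectiveResolution F') (φ ≫ ψ) (θ ≫ φ') (by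
    rw [reassoc_of% hφ, hψ, reassoc_of% w, hφ'])
  rw [resolutionComparison_eq Γ ε q φ hφ, resolutionComparison_eq Γ ε' q φ' hφ', Category.assoc,
    homologyIsoRightDerived_naturality Γ f ψ (InjectiveResolution.desc_commutes_zero _ _ _) q]
  have := (Γ.mapHomotopy h).homologyMap_eq q
  rw [Functor.map_comp, Functor.map_comp, HomologicalComplex.homologyMap_comp,
    HomologicalComplex.homologyMap_comp] at this
  rw [reassoc_of% this]

end Comparison

section InverseImage

variable {X Y : Type u} [MetricSpace X] [MetricSpace Y]

/-- The pullback of global sections `Γ(Y, K) → Γ(X, α^* K)` of a complex of sheaves. -/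
def complexPullback {α : X → Y} (hα : IsCoarse α) (K : CochainComplex (AbSheaf Y) ℕ) :
    ((globalSections Y).mapHomologicalComplex (ComplexShape.up ℕ)).obj K ⟶
      ((globalSections X).mapHomologicalComplex (ComplexShape.up ℕ)).obj
        (((inverseImage α).mapHomologicalComplex (ComplexShape.up ℕ)).obj K) :=
  (NatTrans.mapHomologicalComplex (globalSectionsPullback hα) (ComplexShape.up ℕ)).app K

lemma complexPullback_naturality {α : X → Y} (hα : IsCoarse α) {K L : CochainComplex (AbSheaf Y) ℕ}
    (φ : K ⟶ L) :
    ((globalSections Y).mapHomologicalComplex (ComplexShape.up ℕ)).map φ ≫ complexPullback hα L =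
      complexPullback hα K ≫ ((globalSections X).mapHomologicalComplex (ComplexShape.up ℕ)).map
        (((inverseImage α).mapHomologicalComplex (ComplexShape.up ℕ)).map φ) :=
  (NatTrans.mapHomologicalComplex (globalSectionsPullback hα) (ComplexShape.up ℕ)).naturality φ

/-- The map induced by the inverse image functor, computed with an arbitrary resolution. -/
lemma resolutionComparison_inverseImageCohomology {α : X → Y} (hα : IsCoarse α) {G : AbSheaf Y}
    {K : CochainComplex (AbSheaf Y) ℕ} (ε : (CochainComplex.single₀ (AbSheaf Y)).obj G ⟶ K)
    [QuasiIso ε] [QuasiIso (inverseImageResolution α ε)] (q : ℕ) :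
    resolutionComparison (globalSections Y) ε q ≫ inverseImageCohomology hα G q =
      HomologicalComplex.homologyMap (complexPullback hα K) q ≫
        resolutionComparison (globalSections X) (inverseImageResolution α ε) q := by
  have := inverseImageResolution_quasiIso hα (injectiveResolution G).ι
  obtain ⟨φ, hφ⟩ := exists_lift_of_resolution ε (injectiveResolution G)
  have h1 := resolutionComparison_naturality (globalSections X) (inverseImageResolution α ε)
    (inverseImageResolution α (injectiveResolution G).ι) (𝟙 _)
    (((inverseImage α).mapHomologicalComplex (ComplexShape.up ℕ)).map φ) (by
      rw [CategoryTheory.Functor.map_id, Category.id_comp]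
      unfold inverseImageResolution
      rw [Category.assoc, ← Functor.map_comp, hφ]) q
  rw [CategoryTheory.Functor.map_id, Category.comp_id] at h1
  have h2 : resolutionComparison (globalSections Y) ε q ≫
      (homologyIsoRightDerived (globalSections Y) G q).inv ≫
        HomologicalComplex.homologyMap (complexPullback hα (injectiveResolution G).cocomplex) q ≫
        resolutionComparison (globalSections X)
          (inverseImageResolution α (injectiveResolution G).ι) q =
      HomologicalComplex.homologyMap (complexPullback hα K) q ≫
        resolutionComparison (globalSections X) (inverseImageResolution α ε) q := by
    rw [h1, resolutionComparison_eq _ ε q φ hφ, Category.assoc, Iso.hom_inv_id_assoc,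
      ← Category.assoc, ← HomologicalComplex.homologyMap_comp, complexPullback_naturality,
      HomologicalComplex.homologyMap_comp, Category.assoc]
  exact h2

end InverseImage

section Pullback

variable {X Y : Type u} [MetricSpace X] [MetricSpace Y]

lemma isCoarse_restrictPreimage {α : X → Y} (hα : IsCoarse α) (V : Set Y) :
    IsCoarse (V.restrictPreimage α) where
  uniform R := by
    obtain ⟨S, hS⟩ := hα.uniform R
    exact ⟨S, fun x y h ↦ hS x y h⟩
  proper B hB := by
    have h1 : Bornology.IsBounded (Subtype.val '' B) := by
      obtain ⟨b, hb⟩ := Metric.isBounded_iff.1 hB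
      refine Metric.isBounded_iff.2 ⟨b, ?_⟩
      rintro _ ⟨x, hx, rfl⟩ _ ⟨y, hy, rfl⟩
      exact hb hx hy
    exact ((isCoarse_val (α ⁻¹' V)).proper _ (hα.proper _ h1)).subset
      fun x hx ↦ ⟨_, hx, rfl⟩

variable {α : X → Y} (hα : IsCoarse α) (A : Type u) [AddCommGroup A]

/-- Pulling back blocky functions, as a morphism `CY_b^q( · , A) → α_* CY_b^q( · , A)`. -/
def CYSheafPullback (q : ℕ) : CYSheaf Y A q ⟶ (directImage hα).obj (CYSheaf X A q) where
  hom :=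
    { app := fun V ↦ AddCommGrpCat.ofHom (CYMap A (isCoarse_restrictPreimage hα V.unop) q)
      naturality := fun V W f ↦ by
        ext c
        obtain ⟨φ, rfl⟩ := QuotientAddGroup.mk_surjective (c : CY V.unop A q)
        rfl }

lemma CYSheafPullback_d (q : ℕ) :
    CYSheafPullback hα A q ≫ (directImage hα).map (CYSheafD X A q) =
      CYSheafD Y A q ≫ CYSheafPullback hα A (q + 1) := by
  ext V c
  exact (CYMap_CYd A (isCoarse_restrictPreimage hα V.unop) q c).symm

/-- The morphism `α^* CY_b^q( · , A) → CY_b^q( · , A)` adjoint to the pullback. -/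
def inverseImageCY (q : ℕ) : (inverseImage α).obj (CYSheaf Y A q) ⟶ CYSheaf X A q :=
  ((inverseDirectAdjunction hα).homEquiv _ _).symm (CYSheafPullback hα A q)

lemma inverseImageCY_d (q : ℕ) :
    inverseImageCY hα A q ≫ CYSheafD X A q =
      (inverseImage α).map (CYSheafD Y A q) ≫ inverseImageCY hα A (q + 1) := by
  rw [inverseImageCY, inverseImageCY, ← Adjunction.homEquiv_naturality_right_symm,
    ← Adjunction.homEquiv_naturality_left_symm, CYSheafPullback_d]

/-- The morphism of complexes `α^* CY_b^*( · , A) → CY_b^*( · , A)`. -/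
def inverseImageCYComplex :
    ((inverseImage α).mapHomologicalComplex (ComplexShape.up ℕ)).obj (CYSheafComplex Y A) ⟶
      CYSheafComplex X A where
  f q := inverseImageCY hα A q
  comm' i j h := by
    obtain rfl : i + 1 = j := h
    rw [Functor.mapHomologicalComplex_obj_d, CYSheafComplex_d, CYSheafComplex_d]
    exact inverseImageCY_d hα A i

lemma unit_inverseImageCY (q : ℕ) :
    (inverseDirectAdjunction hα).unit.app (CYSheaf Y A q) ≫
      (directImage hα).map (inverseImageCY hα A q) = CYSheafPullback hα A q :=
  ((inverseDirectAdjunction hα).homEquiv_unit _ _ _).symm.trans (Equiv.apply_symm_apply _ _)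

lemma CYToGlobalSections_complexPullback :
    CYToGlobalSections Y A ≫ complexPullback hα (CYSheafComplex Y A) ≫
        ((globalSections X).mapHomologicalComplex (ComplexShape.up ℕ)).map
          (inverseImageCYComplex hα A) =
      CYComplexMap A hα ≫ CYToGlobalSections X A := by
  ext q c
  have h := ConcreteCategory.congr_hom (NatTrans.congr_app
    (congrArg (fun f ↦ f.hom) (unit_inverseImageCY hα A q)) (op ⊤))
    (CYMap A (isCoarse_val (⊤ : Set Y)) q c)
  refine Eq.trans h ?_
  obtain ⟨φ, rfl⟩ := QuotientAddGroup.mk_surjective (c : CY Y A q)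
  rfl

lemma homEquiv_constToCYSheaf :
    (constantSheafAdj (coarseTopology X) AddCommGrpCat.{u}
      (Preorder.isTerminalTop (Set X))).homEquiv _ _ (constToCYSheaf X A) =
      AddCommGrpCat.ofHom (constToCY A (⊤ : Set X)) := by
  refine (Adjunction.homEquiv_unit _ _ _ _).trans ?_
  refine Eq.trans ?_ (NatTrans.congr_app (toSheafify_constToCYSheaf X A) (op ⊤))
  unfold constantSheafAdj
  refine (congrArg (· ≫ _) (Adjunction.comp_unit_app _ _ _)).trans ?_
  exact (Category.assoc _ _ _).trans (Category.id_comp _)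

lemma inverseImage_constToCYSheaf :
    (inverseImage α).map (constToCYSheaf Y A) ≫ inverseImageCY hα A 0 =
      (inverseImageConst hα A).hom ≫ constToCYSheaf X A := by
  let adj := (constantSheafAdj (coarseTopology Y) AddCommGrpCat.{u}
      (Preorder.isTerminalTop (Set Y))).comp (inverseDirectAdjunction hα)
  apply (adj.homEquiv (AddCommGrpCat.of A) (CYSheaf X A 0)).injective
  have h1 : adj.homEquiv (AddCommGrpCat.of A) (CYSheaf X A 0)
      ((inverseImageConst hα A).hom ≫ constToCYSheaf X A) =
      AddCommGrpCat.ofHom (constToCY A (⊤ : Set X)) := by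
    refine (adj.homEquiv_naturality_right _ _).trans ?_
    refine (congrArg (· ≫ _) (Adjunction.homEquiv_leftAdjointUniq_hom_app adj _ _)).trans ?_
    refine Eq.trans ?_ (homEquiv_constToCYSheaf A)
    exact (Adjunction.homEquiv_unit _ _ _ _).symm
  refine Eq.trans ?_ h1.symm
  have h2 : (inverseDirectAdjunction hα).homEquiv _ _
      ((inverseImage α).map (constToCYSheaf Y A) ≫ inverseImageCY hα A 0) =
      constToCYSheaf Y A ≫ CYSheafPullback hα A 0 := by
    rw [Adjunction.homEquiv_naturality_left, inverseImageCY, Equiv.apply_symm_apply]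
  have h3 : adj.homEquiv (AddCommGrpCat.of A) (CYSheaf X A 0)
      ((inverseImage α).map (constToCYSheaf Y A) ≫ inverseImageCY hα A 0) =
      (constantSheafAdj (coarseTopology Y) AddCommGrpCat.{u}
        (Preorder.isTerminalTop (Set Y))).homEquiv _ _
        ((inverseDirectAdjunction hα).homEquiv _ _
          ((inverseImage α).map (constToCYSheaf Y A) ≫ inverseImageCY hα A 0)) := by
    rw [Adjunction.comp_homEquiv]
    rfl
  rw [h3, h2, Adjunction.homEquiv_naturality_right, homEquiv_constToCYSheaf]
  rfl

lemma inverseImageResolution_CYAugmentation :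
    inverseImageResolution α (CYAugmentation Y A) ≫ inverseImageCYComplex hα A =
      (CochainComplex.single₀ (AbSheaf X)).map (inverseImageConst hα A).hom ≫
        CYAugmentation X A := by
  refine HomologicalComplex.from_single_hom_ext ?_
  have h1 : (inverseImageResolution α (CYAugmentation Y A)).f 0 =
      (inverseImage α).map (constToCYSheaf Y A) := by
    unfold inverseImageResolution
    rw [HomologicalComplex.comp_f, HomologicalComplex.singleMapHomologicalComplex_inv_app_self,
      Functor.mapHomologicalComplex_map_f, CYAugmentation_f_zero]
    exact (congrArg (· ≫ _) ((congrArg (_ ≫ ·) (CategoryTheory.Functor.map_id _ _)).trans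
      (Category.id_comp _))).trans (Category.id_comp _)
  have h2 : ((CochainComplex.single₀ (AbSheaf X)).map (inverseImageConst hα A).hom).f 0 =
      (inverseImageConst hα A).hom := CochainComplex.single₀_map_f_zero _
  rw [HomologicalComplex.comp_f, HomologicalComplex.comp_f, h1, h2, CYAugmentation_f_zero]
  exact inverseImage_constToCYSheaf hα A

lemma isIso_CYToGlobalSections : IsIso (CYToGlobalSections X A) := by
  have hι : IsCoarse (fun x : X ↦ (⟨x, trivial⟩ : (⊤ : Set X))) :=
    ⟨fun R ↦ ⟨R, fun _ _ h ↦ h⟩, fun B hB ↦ by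
      obtain ⟨b, hb⟩ := Metric.isBounded_iff.1 hB
      exact Metric.isBounded_iff.2 ⟨b, fun x hx y hy ↦ hb hx hy⟩⟩
  have (q : ℕ) : IsIso ((CYToGlobalSections X A).f q) := by
    refine ⟨AddCommGrpCat.ofHom (CYMap A hι q), ?_, ?_⟩
    · ext c
      obtain ⟨φ, rfl⟩ := QuotientAddGroup.mk_surjective (c : CY X A q)
      rfl
    · ext c
      obtain ⟨φ, rfl⟩ := QuotientAddGroup.mk_surjective (c : CY (⊤ : Set X) A q)
      rfl
  exact HomologicalComplex.Hom.isIso_of_components _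

lemma isIso_HYComparison (h : QuasiIso (CYAugmentation X A)) (q : ℕ) :
    IsIso (HYComparison X A h q) := by
  have h1 := isIso_CYToGlobalSections (X := X) A
  have h2 := isIso_resolutionComparison_of_flabby (ε := CYAugmentation X A)
    (isFlabby_CYSheaf A) q
  have h3 : IsIso (HomologicalComplex.homologyMap (CYToGlobalSections X A) q) := inferInstance
  exact @IsIso.comp_isIso _ _ _ _ _ _ _ h3 h2

lemma HYComparison_naturality (hX : QuasiIso (CYAugmentation X A))
    (hY : QuasiIso (CYAugmentation Y A)) (q : ℕ) :
    HYComparison Y A hY q ≫ constCohomologyMap hα A q =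
      HYMap A hα q ≫ HYComparison X A hX q := by
  have := inverseImageResolution_quasiIso hα (CYAugmentation Y A)
  have h1 := resolutionComparison_inverseImageCohomology hα (CYAugmentation Y A) q
  have h2 := resolutionComparison_naturality (globalSections X)
    (inverseImageResolution α (CYAugmentation Y A)) (CYAugmentation X A)
    (inverseImageConst hα A).hom (inverseImageCYComplex hα A)
    (inverseImageResolution_CYAugmentation hα A) q
  have h3 := congrArg (fun f ↦ HomologicalComplex.homologyMap f q)
    (CYToGlobalSections_complexPullback hα A)
  simp only [HomologicalComplex.homologyMap_comp] at h3
  have e : HomologicalComplex.homologyMap (CYToGlobalSections Y A) q ≫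
      (resolutionComparison (globalSections Y) (CYAugmentation Y A) q ≫
        inverseImageCohomology hα (constSheaf Y A) q) ≫
          ((globalSections X).rightDerived q).map (inverseImageConst hα A).hom =
      HomologicalComplex.homologyMap (CYComplexMap A hα) q ≫
        HomologicalComplex.homologyMap (CYToGlobalSections X A) q ≫
          resolutionComparison (globalSections X) (CYAugmentation X A) q := by
    rw [h1]
    refine (congrArg (_ ≫ ·) ((Category.assoc _ _ _).trans (congrArg (_ ≫ ·) h2))).trans ?_
    rw [reassoc_of% h3]
  refine Eq.trans ?_ e
  exact (Category.assoc _ _ _).trans (congrArg (_ ≫ ·) (Category.assoc _ _ _).symm)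

end Pullback

end CoarseSheaf

end

theorem mainTheorem9 {X Y : Type u} [MetricSpace X] [MetricSpace Y] (A : Type u) [AddCommGroup A]
    {α : X → Y} (hα : CoarseSheaf.IsCoarse α) (q : ℕ) :
    ∃ (hX : QuasiIso (CoarseSheaf.CYAugmentation X A))
      (hY : QuasiIso (CoarseSheaf.CYAugmentation Y A)),
      IsIso (CoarseSheaf.HYComparison X A hX q) ∧
      IsIso (CoarseSheaf.HYComparison Y A hY q) ∧
      CoarseSheaf.HYComparison Y A hY q ≫ CoarseSheaf.constCohomologyMap hα A q =
        CoarseSheaf.HYMap A hα q ≫ CoarseSheaf.HYComparison X A hX q := by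
  exact ⟨CoarseSheaf.CYAugmentation_quasiIso X A, CoarseSheaf.CYAugmentation_quasiIso Y A,
    CoarseSheaf.isIso_HYComparison A _ q, CoarseSheaf.isIso_HYComparison A _ q,
    CoarseSheaf.HYComparison_naturality hα A _ _ q⟩
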